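/- An effect algebra is a set $E$ with elements $0,1$ and a partial operation $+$ that is commutative and associative (in each law, one side is defined if and only if the other is, and then they are equal), such that for each $a\in E$ there is a unique $a'\in E$ with $a+a'=1$, and such that $a=0$ whenever $a+1$ is defined. It is ordered by $a\le b$ iff $a+c=b$ for some $c\in E$. A $\sigma$-MV-effect algebra is an effect algebra that is a lattice in which every sequence has a supremum and an infimum, and in which $a+b$ is defined whenever $a\wedge b=0$. An observable on $E$ is a mapping $x$ from the Borel $\sigma$-algebra $\mathcal B(\mathbb R)$ to $E$ such that $x(\mathbb R)=1$; $x(A)+x(B)$ is defined and $x(A\cup B)=x(A)+x(B)$ for disjoint $A,B\in\mathcal B(\mathbb R)$; and $x(\bigcup_i A_i)=\bigvee_i x(A_i)$ for every increasing sequence $(A_i)$ of Borel sets. It is bounded if $x([\alpha,\beta])=1$ for some interval $[\alpha,\beta]$. Put $B_x(t):=x((-\infty,t))$ for $t\in\mathbb R$. For $a\in E$, the question $q_a$ is the bounded observable for which $q_a(A)$ is the sum of those of the elements $a'$ (placed at the point $0$) and $a$ (placed at the point $1$) whose points lie in $A$. **Proposition 3.5.** Let $E$ be a $\sigma$-MV-effect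 algebra. For any bounded observables $x,y$ on $E$ there is exactly one bounded observable on $E$, called the sum of $x$ and $y$ and denoted by $x+y$, such that $$B_{x+y}(t)=\bigvee_{r\in\mathbb Q}\bigl(B_x(r)\wedge B_y(t-r)\bigr)\quad\text{for all } t\in\mathbb R.$$ For all bounded observables $x,y,z$ on $E$ we have $x+y=y+x$ and $(x+y)+z=x+(y+z)$, and with $o:=q_0$ we have $x+o=o+x=x$. -/

import Mathlib

/-- An effect algebra. The partial operation is `padd`: `padd a b = some c` says that `a + b` is
defined and equals `c`, and `padd a b = none` says that `a + b` is not defined. Commutativity and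
associativity are equalities of partial values (both sides undefined, or both defined and equal).
The order is the one determined by the partial operation, see `le_iff`. -/
class EffectAlgebra (E : Type*) extends PartialOrder E, Zero E, One E where
  padd : E → E → Option E
  padd_comm : ∀ a b : E, padd a b = padd b a
  padd_assoc : ∀ a b c : E,
    (padd a b).bind (fun s => padd s c) = (padd b c).bind (fun s => padd a s)
  existsUnique_compl : ∀ a : E, ∃! b : E, padd a b = some 1
  eq_zero_of_padd_one : ∀ a : E, (padd a 1).isSome → a = 0
  le_iff : ∀ a b : E, a ≤ b ↔ ∃ c : E, padd a c = some b

/-- A σ-MV-effect algebra: an effect algebra which is a σ-lattice in its order, and in which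
`a ∧ b = 0` implies that `a + b` is defined. -/
class SigmaMVEffectAlgebra (E : Type*) extends EffectAlgebra E, Lattice E where
  isSome_padd_of_inf_eq_zero : ∀ a b : E, a ⊓ b = 0 → (padd a b).isSome
  exists_isLUB_range : ∀ a : ℕ → E, ∃ s : E, IsLUB (Set.range a) s
  exists_isGLB_range : ∀ a : ℕ → E, ∃ s : E, IsGLB (Set.range a) s

namespace EffectAlgebra

variable {E : Type*} [EffectAlgebra E]

/-- The complement `a'`: the unique element with `a + a' = 1`. -/
noncomputable def compl (a : E) : E := (existsUnique_compl a).choose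

theorem padd_compl (a : E) : padd a (compl a) = some 1 :=
  (existsUnique_compl a).choose_spec.1

theorem eq_compl {a b : E} (h : padd a b = some 1) : b = compl a :=
  (existsUnique_compl a).choose_spec.2 b h

theorem compl_compl (a : E) : compl (compl a) = a := by
  refine (eq_compl ?_).symm
  rw [padd_comm, padd_compl]

theorem compl_one : compl (1 : E) = 0 := by
  apply eq_zero_of_padd_one
  rw [padd_comm, padd_compl]
  rfl

theorem padd_zero (a : E) : padd a 0 = some a := by
  have h10 : padd (1 : E) 0 = some 1 := by
    have h := padd_compl (1 : E)
    rwa [compl_one] at h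
  have h := padd_assoc (compl a) a (0 : E)
  rw [padd_comm (compl a) a, padd_compl] at h
  simp only [Option.bind_some, h10] at h
  rcases h2 : padd a 0 with _ | s
  · simp [h2] at h
  · simp only [h2, Option.bind_some] at h
    rw [eq_compl h.symm, compl_compl]

theorem zero_padd (a : E) : padd 0 a = some a := by
  rw [padd_comm, padd_zero]

end EffectAlgebra

/-- An observable on an effect algebra: a mapping from the Borel σ-algebra of the real line. -/
@[ext]
structure Observable (E : Type*) [EffectAlgebra E] where
  toFun : {A : Set ℝ // MeasurableSet A} → E
  map_univ : toFun ⟨Set.univ, MeasurableSet.univ⟩ = 1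
  map_union : ∀ (A B : Set ℝ) (hA : MeasurableSet A) (hB : MeasurableSet B), A ∩ B = ∅ →
    EffectAlgebra.padd (toFun ⟨A, hA⟩) (toFun ⟨B, hB⟩) = some (toFun ⟨A ∪ B, hA.union hB⟩)
  map_iUnion : ∀ (A : ℕ → Set ℝ) (hA : ∀ n, MeasurableSet (A n)), (∀ n, A n ⊆ A (n + 1)) →
    IsLUB (Set.range fun n => toFun ⟨A n, hA n⟩) (toFun ⟨⋃ n, A n, MeasurableSet.iUnion hA⟩)

namespace Observable

variable {E : Type*} [EffectAlgebra E]

/-- The spectral resolution `B_x(t) = x((-∞, t))` of an observable `x`. -/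
def spectral (x : Observable E) (t : ℝ) : E := x.toFun ⟨Set.Iio t, measurableSet_Iio⟩

/-- An observable is bounded if it takes the value `1` at some interval `[α, β]`. -/
def IsBounded (x : Observable E) : Prop :=
  ∃ α β : ℝ, x.toFun ⟨Set.Icc α β, measurableSet_Icc⟩ = 1

open Classical in
/-- The value at `A` of the question corresponding to `a`, that is, the sum of those of the two
elements `a'` (placed at the point `0`) and `a` (placed at the point `1`) whose points lie
in `A`. -/
noncomputable def questionFun (a : E) (A : Set ℝ) : E :=
  if (0 : ℝ) ∈ A then (if (1 : ℝ) ∈ A then 1 else EffectAlgebra.compl a)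
  else (if (1 : ℝ) ∈ A then a else 0)

theorem questionFun_union (a : E) (A B : Set ℝ) (h : A ∩ B = ∅) :
    EffectAlgebra.padd (questionFun a A) (questionFun a B) = some (questionFun a (A ∪ B)) := by
  have h0 : ¬ ((0 : ℝ) ∈ A ∧ (0 : ℝ) ∈ B) := fun hh => by
    have : (0 : ℝ) ∈ A ∩ B := hh
    simp [h] at this
  have h1 : ¬ ((1 : ℝ) ∈ A ∧ (1 : ℝ) ∈ B) := fun hh => by
    have : (1 : ℝ) ∈ A ∩ B := hh
    simp [h] at this
  have hc : EffectAlgebra.padd (EffectAlgebra.compl a) a = some 1 := by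
    rw [EffectAlgebra.padd_comm, EffectAlgebra.padd_compl]
  by_cases hA0 : (0 : ℝ) ∈ A <;> by_cases hB0 : (0 : ℝ) ∈ B <;>
    by_cases hA1 : (1 : ℝ) ∈ A <;> by_cases hB1 : (1 : ℝ) ∈ B <;>
    simp_all [questionFun, EffectAlgebra.padd_zero, EffectAlgebra.zero_padd,
      EffectAlgebra.padd_compl]

theorem questionFun_mono (a : E) {A B : Set ℝ} (h : A ⊆ B) :
    questionFun a A ≤ questionFun a B := by
  refine (EffectAlgebra.le_iff _ _).2 ⟨questionFun a (B \ A), ?_⟩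
  rw [questionFun_union a A (B \ A) (by simp), Set.union_sdiff_cancel h]

theorem questionFun_congr (a : E) {A B : Set ℝ} (h0 : (0 : ℝ) ∈ A ↔ (0 : ℝ) ∈ B)
    (h1 : (1 : ℝ) ∈ A ↔ (1 : ℝ) ∈ B) : questionFun a A = questionFun a B := by
  by_cases hB0 : (0 : ℝ) ∈ B <;> by_cases hB1 : (1 : ℝ) ∈ B <;>
    simp [questionFun, h0, h1, hB0, hB1]

/-- The question `q_a` corresponding to an element `a`. -/
noncomputable def question (a : E) : Observable E where
  toFun A := questionFun a A.1
  map_univ := by simp [questionFun]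
  map_union A B _ _ h := questionFun_union a A B h
  map_iUnion A hA hm := by
    have hmono : Monotone A := monotone_nat_of_le_succ hm
    have key : ∀ t : ℝ, ∃ N, ∀ n, N ≤ n → (t ∈ A n ↔ t ∈ ⋃ k, A k) := by
      intro t
      by_cases ht : t ∈ ⋃ k, A k
      · obtain ⟨N, hN⟩ := Set.mem_iUnion.1 ht
        exact ⟨N, fun n hn => ⟨fun _ => ht, fun _ => hmono hn hN⟩⟩
      · exact ⟨0, fun n _ => ⟨fun h => Set.mem_iUnion.2 ⟨n, h⟩, fun h => absurd h ht⟩⟩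
    obtain ⟨N, hN⟩ := key 0
    obtain ⟨M, hM⟩ := key 1
    constructor
    · rintro _ ⟨n, rfl⟩
      exact questionFun_mono a (Set.subset_iUnion A n)
    · intro u hu
      have h := hu ⟨max N M, rfl⟩
      have e : questionFun a (A (max N M)) = questionFun a (⋃ k, A k) :=
        questionFun_congr a (hN _ (le_max_left N M)) (hM _ (le_max_right N M))
      rw [← e]
      exact h

theorem question_isBounded (a : E) : (question a).IsBounded :=
  ⟨0, 1, by simp [question, questionFun]⟩

end Observable

/-- The set of bounded observables on an effect algebra. -/
def BoundedObservable (E : Type*) [EffectAlgebra E] : Type _ :=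
  {x : Observable E // x.IsBounded}

namespace BoundedObservable

/-- The question `q_a` as a bounded observable. -/
noncomputable def question {E : Type*} [EffectAlgebra E] (a : E) : BoundedObservable E :=
  ⟨Observable.question a, Observable.question_isBounded a⟩

/-- The defining property of the sum `z` of `x` and `y`: for every real `t`, `B_z(t)` is the
supremum over the rational numbers `r` of `B_x(r) ∧ B_y(t - r)`. -/
def IsSum {E : Type*} [SigmaMVEffectAlgebra E] (x y z : BoundedObservable E) : Prop :=
  ∀ t : ℝ, IsLUB (Set.range fun r : ℚ => x.1.spectral (r : ℝ) ⊓ y.1.spectral (t - (r : ℝ)))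
    (z.1.spectral t)

/-- The sum of two bounded observables: the bounded observable `z` with `IsSum x y z`. (That there
is exactly one such `z` is not built into this definition.) -/
noncomputable instance {E : Type*} [SigmaMVEffectAlgebra E] : Add (BoundedObservable E) where
  add x y := @Classical.epsilon _ ⟨question (0 : E)⟩ (IsSum x y)

end BoundedObservable

/-! Uniqueness is a π-λ argument: an observable is determined by its values at rational half-lines
(`Observable.ext_spectral`). Existence rests on a converse: every bounded left continuous `B : ℝ →
E` is the spectral resolution of an observable (`IsSpectral.exists_observable`).

This converse is a Loomis–Sikorski type argument. Homomorphisms `h : E → [0,1]` form a compact space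
and separate the elements of `E` (`exists_isMVHom_pos`). Suprema in `E` are pointwise suprema at all
`h` outside a meagre set (`eventually_isLUB`), and by Baire's theorem such `h` still determine the
order. Generically at each rational point, `h ∘ B` is thus the distribution function of a
probability measure `μ h`. The Borel sets `A` for which `h ↦ μ h A` is generically the evaluation at
an element of `E` form a Dynkin system containing the rational half-lines; these elements are the
values of the observable.

For the algebraic laws, left continuity and distributivity of meets over suprema rewrite the sum as
the supremum of `B_x(r) ∧ B_y(s)` over rational `r + s < t` (`isSum_iff`), a form symmetric in `x`
and `y` that iterates. -/

open Filter Topology MeasureTheory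

/-! ### Calculus of partial sums in an effect algebra. -/

namespace EffectAlgebra

section Basic

variable {E : Type*} [EffectAlgebra E]

/-- `PSum a b c` says that `a + b` is defined and equals `c`. -/
def PSum (a b c : E) : Prop := padd a b = some c

theorem PSum.comm {a b c : E} (h : PSum a b c) : PSum b a c := by
  unfold PSum at *; rwa [padd_comm]

theorem PSum.unique {a b c d : E} (h : PSum a b c) (h' : PSum a b d) : c = d := by
  unfold PSum at *; rw [h] at h'; exact Option.some.inj h'

theorem PSum.assoc {a b c s t : E} (h : PSum a b s) (h' : PSum s c t) :
    ∃ u, PSum b c u ∧ PSum a u t := by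
  unfold PSum at *
  have := padd_assoc a b c
  rw [h, Option.bind_some, h'] at this
  rcases h2 : padd b c with _ | u
  · simp [h2] at this
  · rw [h2, Option.bind_some] at this
    exact ⟨u, rfl, this.symm⟩

theorem PSum.assoc_symm {a b c u t : E} (h : PSum b c u) (h' : PSum a u t) :
    ∃ s, PSum a b s ∧ PSum s c t := by
  obtain ⟨v, hv, hv'⟩ := h.comm.assoc h'.comm
  exact ⟨v, hv.comm, hv'.comm⟩

theorem psum_compl (a : E) : PSum a (compl a) 1 := padd_compl a

theorem psum_zero (a : E) : PSum a 0 a := padd_zero a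

theorem zero_psum (a : E) : PSum 0 a a := zero_padd a

theorem PSum.cancel_left {a b b' c : E} (h : PSum a b c) (h' : PSum a b' c) : b = b' := by
  obtain ⟨u, hu, hu'⟩ := h.comm.assoc (psum_compl c)
  obtain ⟨v, hv, hv'⟩ := h'.comm.assoc (psum_compl c)
  rw [hu.unique hv] at hu'
  rw [eq_compl hu'.comm, eq_compl hv'.comm]

theorem PSum.le_left {a b c : E} (h : PSum a b c) : a ≤ c := (le_iff a c).2 ⟨b, h⟩

theorem PSum.le_right {a b c : E} (h : PSum a b c) : b ≤ c := h.comm.le_left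

theorem exists_psum {a b : E} (h : a ≤ b) : ∃ d, PSum a d b := (le_iff a b).1 h

theorem zero_le' (a : E) : 0 ≤ a := (zero_psum a).le_left

theorem le_one' (a : E) : a ≤ 1 := (psum_compl a).le_left

theorem eq_zero_of_le {a : E} (h : a ≤ 0) : a = 0 := le_antisymm h (zero_le' a)

theorem compl_zero : compl (0 : E) = 1 := by rw [← compl_one, compl_compl]

theorem PSum.le_iff_right {a b c b' c' : E} (h : PSum a b c) (h' : PSum a b' c') :
    b ≤ b' ↔ c ≤ c' := by
  constructor
  · intro hb
    obtain ⟨d, hd⟩ := exists_psum hb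
    obtain ⟨s, hs, hs'⟩ := hd.assoc_symm h'
    rw [h.unique hs]; exact hs'.le_left
  · intro hc
    obtain ⟨d, hd⟩ := exists_psum hc
    obtain ⟨u, hu, hu'⟩ := h.assoc hd
    rw [h'.cancel_left hu']; exact hu.le_left

theorem PSum.le_of_le {a b c a' b' : E} (h : PSum a b c) (h' : PSum a' b' c) (ha : a ≤ a') :
    b' ≤ b := by
  obtain ⟨d, hd⟩ := exists_psum ha
  obtain ⟨u, hu, hu'⟩ := hd.assoc h'
  rw [h.cancel_left hu']; exact hu.le_right

theorem compl_le_compl {a b : E} (h : a ≤ b) : compl b ≤ compl a :=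
  (psum_compl a).le_of_le (psum_compl b) h

theorem PSum.le_compl {a b c : E} (h : PSum a b c) : b ≤ compl a := by
  obtain ⟨u, hu, hu'⟩ := h.assoc (psum_compl c)
  rw [← eq_compl hu']; exact hu.le_left

theorem exists_psum_of_le_compl {a b : E} (h : b ≤ compl a) : ∃ c, PSum a b c := by
  obtain ⟨d, hd⟩ := exists_psum h
  obtain ⟨s, hs, _⟩ := hd.assoc_symm (psum_compl a)
  exact ⟨s, hs⟩

theorem PSum.mono {a b c a' b' : E} (h : PSum a b c) (ha : a' ≤ a) (hb : b' ≤ b) :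
    ∃ c', PSum a' b' c' ∧ c' ≤ c := by
  obtain ⟨c', hc'⟩ := exists_psum_of_le_compl (hb.trans (h.le_compl.trans (compl_le_compl ha)))
  refine ⟨c', hc', ?_⟩
  obtain ⟨d, hd⟩ := exists_psum_of_le_compl (h.le_compl.trans (compl_le_compl ha))
  exact ((hc'.le_iff_right hd).1 hb).trans ((hd.comm.le_iff_right h.comm).1 ha)

theorem PSum.eq_zero_of_eq {a b : E} (h : PSum a b a) : b = 0 := h.cancel_left (psum_zero a)

end Basic

/-! ### The truncated sum and the Archimedean property. -/

section MV

variable {E : Type*} [SigmaMVEffectAlgebra E]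

/-- The MV identity `(a ∨ b) ⊖ b = a ⊖ (a ∧ b)`. The differences `p`, `q` of `a ∨ b` with `a`, `b`
are disjoint, so `p + q` exists and lies below `a ∨ b`; what remains of `a ∨ b` is `a ∧ b`. -/
theorem psum_sup_of_psum_inf {a b d : E} (h : PSum (a ⊓ b) d a) : PSum b d (a ⊔ b) := by
  obtain ⟨p, hp⟩ := exists_psum (le_sup_left : a ≤ a ⊔ b)
  obtain ⟨q, hq⟩ := exists_psum (le_sup_right : b ≤ a ⊔ b)
  have hpq : p ⊓ q = 0 := by
    -- The complement `v` of `p ∧ q` in `a ∨ b` is above both `a` and `b`, hence is all of `a ∨ b`.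
    obtain ⟨v, hv⟩ := exists_psum (inf_le_left.trans hp.le_right : p ⊓ q ≤ a ⊔ b)
    have h1 : a ≤ v := hv.le_of_le hp.comm inf_le_left
    have h2 : b ≤ v := hv.le_of_le hq.comm inf_le_right
    have h3 : v = a ⊔ b := le_antisymm hv.le_right (sup_le h1 h2)
    rw [h3] at hv
    exact hv.comm.eq_zero_of_eq
  obtain ⟨f, hf⟩ := Option.isSome_iff_exists.1
    (SigmaMVEffectAlgebra.isSome_padd_of_inf_eq_zero p q hpq)
  change PSum p q f at hf
  have hfe : f ≤ p ⊔ q := by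
    obtain ⟨g, hg⟩ := exists_psum (sup_le hf.le_left hf.le_right)
    have key : ∀ {p q s : E}, PSum p q f → PSum s g f → p ≤ s → g ≤ q := by
      intro p q s hf hg hs
      obtain ⟨s1, hs1⟩ := exists_psum hs
      obtain ⟨u, hu, hu'⟩ := hs1.assoc hg
      rw [hf.cancel_left hu']
      exact hu.le_right
    have h3 : g = 0 :=
      eq_zero_of_le (hpq ▸ le_inf (key hf.comm hg le_sup_right) (key hf hg le_sup_left))
    rw [h3] at hg
    exact (hg.unique (psum_zero _)).le
  obtain ⟨g, hg⟩ := exists_psum (hfe.trans (sup_le hp.le_right hq.le_right))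
  obtain ⟨u, hu, hu'⟩ := hf.assoc hg
  rw [← hp.comm.cancel_left hu'] at hu
  obtain ⟨v, hv, hv'⟩ := hf.comm.assoc hg
  rw [← hq.comm.cancel_left hv'] at hv
  have hgab : g = a ⊓ b := by
    refine le_antisymm (le_inf hu.le_right hv.le_right) ?_
    obtain ⟨w, hw⟩ := exists_psum (inf_le_left.trans le_sup_left : a ⊓ b ≤ a ⊔ b)
    have h1 : p ≤ w := hw.le_of_le hp inf_le_left
    have h2 : q ≤ w := hw.le_of_le hq inf_le_right
    exact hg.le_of_le hw.comm (hfe.trans (sup_le h1 h2))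
  rw [hgab] at hu
  rw [h.cancel_left hu.comm]
  exact hq

theorem exists_psum_oplus (a b : E) : ∃ c, PSum a (b ⊓ compl a) c :=
  exists_psum_of_le_compl inf_le_right

/-- The truncated sum of an MV-algebra, `a + (b ∧ a')`. -/
noncomputable def oplus (a b : E) : E := (exists_psum_oplus a b).choose

theorem psum_oplus (a b : E) : PSum a (b ⊓ compl a) (oplus a b) :=
  (exists_psum_oplus a b).choose_spec

/-- Riesz decomposition: take `x = (x ∧ a) + d`; then `a + d = x ∨ a`, so `d` is compared with `b ∧
a'` by cancelling `a`. Commutativity and associativity of `oplus` thereby reduce to those of partial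
sums. -/
theorem le_oplus_iff {a b x : E} : x ≤ oplus a b ↔ ∃ x₁ ≤ a, ∃ x₂ ≤ b, PSum x₁ x₂ x := by
  constructor
  · intro h
    obtain ⟨d, hd⟩ := exists_psum (inf_le_left : x ⊓ a ≤ x)
    refine ⟨x ⊓ a, inf_le_right, d, ?_, hd⟩
    exact (((psum_sup_of_psum_inf hd).le_iff_right (psum_oplus a b)).2
      (sup_le h (psum_oplus a b).le_left)).trans inf_le_left
  · rintro ⟨x₁, h₁, x₂, h₂, h⟩
    obtain ⟨d, hd⟩ := exists_psum (inf_le_left : x ⊓ a ≤ x)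
    have hdx : d ≤ x₂ := h.le_of_le hd (le_inf h.le_left h₁)
    have hs := psum_sup_of_psum_inf hd
    exact le_sup_left.trans
      ((hs.le_iff_right (psum_oplus a b)).1 (le_inf (hdx.trans h₂) hs.le_compl))

theorem oplus_comm (a b : E) : oplus a b = oplus b a := by
  refine eq_of_forall_le_iff fun x => ?_
  rw [le_oplus_iff, le_oplus_iff]
  exact ⟨fun ⟨x₁, h₁, x₂, h₂, h⟩ => ⟨x₂, h₂, x₁, h₁, h.comm⟩,
    fun ⟨x₁, h₁, x₂, h₂, h⟩ => ⟨x₂, h₂, x₁, h₁, h.comm⟩⟩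

theorem oplus_assoc (a b c : E) : oplus (oplus a b) c = oplus a (oplus b c) := by
  refine eq_of_forall_le_iff fun x => ?_
  simp only [le_oplus_iff]
  constructor
  · rintro ⟨_, ⟨x₁, h₁, x₂, h₂, h⟩, x₃, h₃, h'⟩
    obtain ⟨u, hu, hu'⟩ := h.assoc h'
    exact ⟨x₁, h₁, u, ⟨x₂, h₂, x₃, h₃, hu⟩, hu'⟩
  · rintro ⟨x₁, h₁, _, ⟨x₂, h₂, x₃, h₃, h⟩, h'⟩
    obtain ⟨u, hu, hu'⟩ := h.assoc_symm h'
    exact ⟨u, ⟨x₁, h₁, x₂, h₂, hu⟩, x₃, h₃, hu'⟩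

instance : Std.Commutative (oplus : E → E → E) := ⟨oplus_comm⟩

instance : Std.Associative (oplus : E → E → E) := ⟨oplus_assoc⟩

theorem oplus_mono {a a' b b' : E} (ha : a ≤ a') (hb : b ≤ b') : oplus a b ≤ oplus a' b' := by
  obtain ⟨x₁, h₁, x₂, h₂, h⟩ := le_oplus_iff.1 (le_refl (oplus a b))
  exact le_oplus_iff.2 ⟨x₁, h₁.trans ha, x₂, h₂.trans hb, h⟩

theorem le_oplus_left (a b : E) : a ≤ oplus a b := (psum_oplus a b).le_left

theorem le_oplus_right (a b : E) : b ≤ oplus a b := oplus_comm a b ▸ le_oplus_left b a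

theorem PSum.oplus_eq {a b c : E} (h : PSum a b c) : oplus a b = c := by
  have := psum_oplus a b
  rw [inf_eq_left.2 h.le_compl] at this
  exact this.unique h

theorem oplus_zero (a : E) : oplus a 0 = a := (psum_zero a).oplus_eq

theorem zero_oplus (a : E) : oplus 0 a = a := (zero_psum a).oplus_eq

theorem PSum.le_of_le_oplus {a b c d : E} (h : PSum a b c) (h' : c ≤ oplus a d) : b ≤ d :=
  ((h.le_iff_right (psum_oplus a d)).2 h').trans inf_le_left

theorem inf_oplus_le (x a b : E) : x ⊓ oplus a b ≤ oplus (x ⊓ a) (x ⊓ b) := by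
  obtain ⟨y₁, h₁, y₂, h₂, h⟩ := le_oplus_iff.1 (inf_le_right : x ⊓ oplus a b ≤ oplus a b)
  exact le_oplus_iff.2 ⟨y₁, le_inf (h.le_left.trans inf_le_left) h₁,
    y₂, le_inf (h.le_right.trans inf_le_left) h₂, h⟩

theorem inf_oplus_eq_zero {x a b : E} (ha : x ⊓ a = 0) (hb : x ⊓ b = 0) :
    x ⊓ oplus a b = 0 := by
  have := inf_oplus_le x a b
  rw [ha, hb, oplus_zero] at this
  exact eq_zero_of_le this

theorem inf_eq_zero_of_psum_inf {a b p q : E} (hp : PSum (a ⊓ b) p a) (hq : PSum (a ⊓ b) q b) :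
    p ⊓ q = 0 := by
  obtain ⟨u, hu, hu'⟩ := hp.mono le_rfl (inf_le_left : p ⊓ q ≤ p)
  obtain ⟨v, hv, hv'⟩ := hq.mono le_rfl (inf_le_right : p ⊓ q ≤ q)
  rw [← hu.unique hv] at hv'
  rw [le_antisymm (le_inf hu' hv') hu.le_left] at hu
  exact hu.eq_zero_of_eq

/-- The truncated multiple `a ⊕ ⋯ ⊕ a`. -/
noncomputable def onsmul (n : ℕ) (a : E) : E := (oplus a)^[n] 0

theorem onsmul_zero (a : E) : onsmul 0 a = 0 := rfl

theorem onsmul_succ (n : ℕ) (a : E) : onsmul (n + 1) a = oplus a (onsmul n a) :=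
  Function.iterate_succ_apply' _ _ _

theorem onsmul_add (m n : ℕ) (a : E) :
    onsmul (m + n) a = oplus (onsmul m a) (onsmul n a) := by
  induction m with
  | zero => rw [Nat.zero_add, onsmul_zero, zero_oplus]
  | succ m ih => rw [Nat.succ_add, onsmul_succ, ih, onsmul_succ, oplus_assoc]

theorem inf_onsmul_eq_zero {x a : E} (h : x ⊓ a = 0) (n : ℕ) : x ⊓ onsmul n a = 0 := by
  induction n with
  | zero => exact eq_zero_of_le inf_le_right
  | succ n ih => rw [onsmul_succ]; exact inf_oplus_eq_zero h ih

/-- A σ-complete MV-effect algebra is Archimedean. -/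
theorem exists_not_onsmul_le_compl {c : E} (hc : c ≠ 0) : ∃ n, ¬ onsmul n c ≤ compl c := by
  by_contra! h
  obtain ⟨s, hs⟩ := SigmaMVEffectAlgebra.exists_isLUB_range fun n => onsmul n c
  have hcs : c ≤ s := by
    have : onsmul 1 c ≤ s := hs.1 ⟨1, rfl⟩
    rwa [onsmul_succ, onsmul_zero, oplus_zero] at this
  obtain ⟨d, hd⟩ := exists_psum hcs
  -- With `s = c + d`, cancelling `c` in `c + n c = (n + 1) c ≤ s` gives `n c ≤ d` for every `n`.
  have hsd : s ≤ d := by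
    refine hs.2 ?_
    rintro _ ⟨n, rfl⟩
    obtain ⟨u, hu⟩ := exists_psum_of_le_compl (h n)
    refine (hu.le_iff_right hd).2 ?_
    rw [← hu.oplus_eq, ← onsmul_succ]
    exact hs.1 ⟨n + 1, rfl⟩
  rw [le_antisymm hd.le_right hsd] at hd
  exact hc hd.comm.eq_zero_of_eq

end MV

end EffectAlgebra

/-! ### Homomorphisms to the unit interval and maximal ideals. -/

namespace EffectAlgebra

section Hom

variable {E : Type*} [SigmaMVEffectAlgebra E]

/-- A homomorphism of MV-effect algebras to the real unit interval. -/
structure IsMVHom (h : E → ℝ) : Prop where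
  map_one : h 1 = 1
  nonneg : ∀ a, 0 ≤ h a
  map_psum : ∀ a b c, PSum a b c → h c = h a + h b
  eq_zero_or : ∀ a b, a ⊓ b = 0 → h a = 0 ∨ h b = 0

namespace IsMVHom

variable {h : E → ℝ} (hh : IsMVHom h)
include hh

theorem mono {a b : E} (hab : a ≤ b) : h a ≤ h b := by
  obtain ⟨d, hd⟩ := exists_psum hab
  rw [hh.map_psum _ _ _ hd]
  linarith [hh.nonneg d]

theorem map_zero : h 0 = 0 := by
  have := hh.map_psum _ _ _ (psum_zero (0 : E))
  linarith

theorem le_one (a : E) : h a ≤ 1 := hh.map_one ▸ hh.mono (le_one' a)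

theorem map_compl (a : E) : h (compl a) = 1 - h a := by
  have := hh.map_psum _ _ _ (psum_compl a)
  rw [hh.map_one] at this
  linarith

theorem map_inf (a b : E) : h (a ⊓ b) = min (h a) (h b) := by
  obtain ⟨p, hp⟩ := exists_psum (inf_le_left : a ⊓ b ≤ a)
  obtain ⟨q, hq⟩ := exists_psum (inf_le_right : a ⊓ b ≤ b)
  have ha := hh.map_psum _ _ _ hp
  have hb := hh.map_psum _ _ _ hq
  rcases hh.eq_zero_or p q (inf_eq_zero_of_psum_inf hp hq) with h0 | h0
  · rw [min_eq_left] <;> linarith [hh.nonneg q]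
  · rw [min_eq_right] <;> linarith [hh.nonneg p]

theorem map_oplus (a b : E) : h (oplus a b) = min 1 (h a + h b) := by
  rw [hh.map_psum _ _ _ (psum_oplus a b), hh.map_inf, hh.map_compl]
  rcases le_total (h b) (1 - h a) with h1 | h1
  · rw [min_eq_left h1, min_eq_right (by linarith)]
  · rw [min_eq_right h1, min_eq_left (by linarith)]
    ring

end IsMVHom

/-- Ideals of MV-effect algebras. -/
structure IsMVIdeal (M : Set E) : Prop where
  zero_mem : 0 ∈ M
  mem_of_le : ∀ a b, a ≤ b → b ∈ M → a ∈ M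
  oplus_mem : ∀ a b, a ∈ M → b ∈ M → oplus a b ∈ M

/-- Maximal proper ideals, characterized by a property of the elements outside of the ideal. -/
structure IsMVMaximal (M : Set E) : Prop extends IsMVIdeal M where
  one_notMem : 1 ∉ M
  exists_eq_one : ∀ ε, ε ∉ M → ∃ k, ∃ m ∈ M, oplus (onsmul k ε) m = 1

theorem IsMVIdeal.sup {M : Set E} (hM : IsMVIdeal M) (ε : E) :
    IsMVIdeal {x | ∃ k, ∃ m ∈ M, x ≤ oplus (onsmul k ε) m} where
  zero_mem := ⟨0, 0, hM.zero_mem, zero_le' _⟩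
  mem_of_le := fun a b hab ⟨k, m, hm, h⟩ => ⟨k, m, hm, hab.trans h⟩
  oplus_mem := fun a b ⟨k, m, hm, h⟩ ⟨l, n, hn, h'⟩ => by
    refine ⟨k + l, oplus m n, hM.oplus_mem _ _ hm hn, (oplus_mono h h').trans (le_of_eq ?_)⟩
    rw [onsmul_add]
    ac_rfl

theorem IsMVIdeal.exists_maximal {I : Set E} (hI : IsMVIdeal I) (h1 : 1 ∉ I) :
    ∃ M, I ⊆ M ∧ IsMVMaximal M := by
  obtain ⟨M, hIM, hM⟩ := zorn_subset_nonempty {M : Set E | IsMVIdeal M ∧ 1 ∉ M} (by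
    intro c hc hchain hne
    refine ⟨⋃₀ c, ⟨⟨?_, ?_, ?_⟩, ?_⟩, fun s hs => Set.subset_sUnion_of_mem hs⟩
    · obtain ⟨s, hs⟩ := hne
      exact ⟨s, hs, (hc hs).1.zero_mem⟩
    · rintro a b hab ⟨s, hs, hb⟩
      exact ⟨s, hs, (hc hs).1.mem_of_le a b hab hb⟩
    · rintro a b ⟨s, hs, ha⟩ ⟨t, ht, hb⟩
      rcases hchain.total hs ht with hst | hst
      · exact ⟨t, ht, (hc ht).1.oplus_mem a b (hst ha) hb⟩
      · exact ⟨s, hs, (hc hs).1.oplus_mem a b ha (hst hb)⟩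
    · rintro ⟨s, hs, h⟩
      exact (hc hs).2 h) I ⟨hI, h1⟩
  refine ⟨M, hIM, hM.prop.1, hM.prop.2, fun ε hε => ?_⟩
  by_contra! hcon
  -- Were the conclusion false, the ideal generated by `M` and `ε` would be proper, hence equal to
  -- `M`.
  have hle := hM.le_of_ge (y := {x | ∃ k, ∃ m ∈ M, x ≤ oplus (onsmul k ε) m})
    ⟨hM.prop.1.sup ε, fun ⟨k, m, hm, h⟩ => hcon k m hm (le_antisymm (le_one' _) h)⟩
    (fun x hx => ⟨0, x, hx, le_oplus_right _ _⟩)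
  exact hε (hle ⟨1, 0, hM.prop.1.zero_mem, by
    rw [onsmul_succ, onsmul_zero, oplus_zero, oplus_zero]⟩)

theorem IsMVIdeal.mem_of_psum {M : Set E} (hM : IsMVIdeal M) {a b c : E} (h : PSum a b c)
    (ha : a ∈ M) (hb : b ∈ M) : c ∈ M :=
  h.oplus_eq ▸ hM.oplus_mem a b ha hb

/-- Maximal ideals are prime: if `a ∉ M`, then `1 = k a ⊕ m`, and meeting with `b` kills `k a`, so
`b ≤ m`. -/
theorem IsMVMaximal.mem_or_mem {M : Set E} (hM : IsMVMaximal M) {a b : E} (h : a ⊓ b = 0) :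
    a ∈ M ∨ b ∈ M := by
  by_contra! hcon
  obtain ⟨k, m, hm, h1⟩ := hM.exists_eq_one a hcon.1
  have h2 := inf_oplus_le b (onsmul k a) m
  rw [h1, inf_onsmul_eq_zero (inf_comm a b ▸ h), zero_oplus, inf_eq_left.2 (le_one' b)] at h2
  exact hcon.2 (hM.mem_of_le _ _ (h2.trans inf_le_right) hm)

/-- `k` copies of `ε` fit into `a`, modulo the ideal `M`. -/
def Fits (M : Set E) (ε : E) : ℕ → E → Prop
  | 0, _ => True
  | k + 1, a => ∃ e b, PSum e b a ∧ (∃ m ∈ M, ε ≤ oplus e m) ∧ Fits M ε k b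

/-- `k` copies of `ε` cover `a`, modulo the ideal `M`. -/
def Covers (M : Set E) (ε : E) (k : ℕ) (a : E) : Prop := ∃ m ∈ M, a ≤ oplus (onsmul k ε) m

/-! ### Measuring elements by copies of a small `ε`, modulo an ideal. -/

section Counting

variable {M : Set E} {ε : E}

theorem Fits.of_succ {k : ℕ} {a : E} (h : Fits M ε (k + 1) a) : Fits M ε k a := by
  induction k generalizing a with
  | zero => trivial
  | succ k ih =>
    obtain ⟨e, b, hs, he, hb⟩ := h
    exact ⟨e, b, hs, he, ih hb⟩

theorem Fits.add {k l : ℕ} {a b c : E} (ha : Fits M ε k a) (hb : Fits M ε l b)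
    (h : PSum a b c) : Fits M ε (k + l) c := by
  induction k generalizing a c with
  | zero =>
    rw [Nat.zero_add]
    clear ha
    induction l generalizing a b c with
    | zero => trivial
    | succ l ih =>
      obtain ⟨e, b', hs, he, hb'⟩ := hb
      obtain ⟨u, hu, hu'⟩ := hs.assoc h.comm
      exact ⟨e, u, hu', he, ih hb' hu.comm⟩
  | succ k ih =>
    obtain ⟨e, a', hs, he, ha'⟩ := ha
    obtain ⟨u, hu, hu'⟩ := hs.assoc h
    rw [Nat.succ_add]
    exact ⟨e, u, hu', he, ih ha' hu⟩

theorem Covers.add (hM : IsMVIdeal M) {k l : ℕ} {a b c : E} (ha : Covers M ε k a)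
    (hb : Covers M ε l b) (h : PSum a b c) : Covers M ε (k + l) c := by
  obtain ⟨m, hm, ha⟩ := ha
  obtain ⟨n, hn, hb⟩ := hb
  refine ⟨oplus m n, hM.oplus_mem _ _ hm hn, ?_⟩
  rw [← h.oplus_eq]
  refine (oplus_mono ha hb).trans (le_of_eq ?_)
  rw [onsmul_add]
  ac_rfl

theorem Covers.cancel (hM : IsMVIdeal M) {l : ℕ} {e b a m : E} (h : PSum e b a) (hm : m ∈ M)
    (he : ε ≤ oplus e m) (ha : Covers M ε (l + 1) a) : Covers M ε l b := by
  obtain ⟨n, hn, ha⟩ := ha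
  refine ⟨oplus m n, hM.oplus_mem _ _ hm hn, h.le_of_le_oplus (ha.trans ?_)⟩
  rw [onsmul_succ]
  refine (oplus_mono (oplus_mono he le_rfl) le_rfl).trans (le_of_eq ?_)
  ac_rfl

theorem Fits.le_of_covers (hM : IsMVIdeal M) (hε : ε ∉ M) {k l : ℕ} {a : E}
    (hk : Fits M ε k a) (hl : Covers M ε l a) : k ≤ l := by
  induction k generalizing l a with
  | zero => exact Nat.zero_le l
  | succ k ih =>
    obtain ⟨e, b, hs, ⟨m, hm, he⟩, hb⟩ := hk
    cases l with
    | zero =>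
      obtain ⟨n, hn, ha⟩ := hl
      rw [onsmul_zero, zero_oplus] at ha
      exact absurd (hM.mem_of_le _ _ he (hM.oplus_mem _ _
        (hM.mem_of_le _ _ (hs.le_left.trans ha) hn) hm)) hε
    | succ l => exact Nat.succ_le_succ (ih hb (hl.cancel hM hs hm he))

/-- Division with remainder: subtract `a ∧ ε` from `a` as long as this is `ε` modulo `M`; once it is
not, `hr` covers what is left by `r` copies. The bound `K` ensures termination. -/
theorem exists_fits_covers (hM : IsMVIdeal M) {r : ℕ}
    (hr : ∀ a q, PSum (a ⊓ ε) q ε → q ∉ M → Covers M ε r a) {K : ℕ} {a : E}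
    (hK : Covers M ε K a) : ∃ k, Fits M ε k a ∧ Covers M ε (k + r) a := by
  induction K generalizing a with
  | zero =>
    obtain ⟨m, hm, ha⟩ := hK
    rw [onsmul_zero, zero_oplus] at ha
    exact ⟨0, trivial, m, hm, ha.trans (le_oplus_right _ _)⟩
  | succ K ih =>
    obtain ⟨q, hq⟩ := exists_psum (inf_le_right : a ⊓ ε ≤ ε)
    by_cases hqM : q ∈ M
    · obtain ⟨p, hp⟩ := exists_psum (inf_le_left : a ⊓ ε ≤ a)
      obtain ⟨k, hk, hk'⟩ := ih (hK.cancel hM hp hqM hq.oplus_eq.ge)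
      refine ⟨k + 1, ⟨_, p, hp, ⟨q, hqM, hq.oplus_eq.ge⟩, hk⟩, ?_⟩
      have h1 : Covers M ε 1 (a ⊓ ε) := ⟨0, hM.zero_mem, by
        rw [onsmul_succ, onsmul_zero, oplus_zero, oplus_zero]; exact inf_le_right⟩
      have := h1.add hM hk' hp
      rwa [Nat.add_comm 1, Nat.add_right_comm] at this
    · exact ⟨0, trivial, by rw [Nat.zero_add]; exact hr a q hq hqM⟩

theorem IsMVMaximal.covers (hM : IsMVMaximal M) (hε : ε ∉ M) : ∃ K, ∀ a, Covers M ε K a := by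
  obtain ⟨k, m, hm, h⟩ := hM.exists_eq_one ε hε
  exact ⟨k, fun a => ⟨m, hm, h ▸ le_one' a⟩⟩

/-- Each copy of `ε = r + s` contains two disjoint copies of `r ∧ s`. -/
theorem Fits.half {r s : E} (h : PSum r s ε) {k : ℕ} {a : E}
    (ha : Fits M ε k a) : Fits M (r ⊓ s) (2 * k) a := by
  induction k generalizing a with
  | zero => trivial
  | succ k ih =>
    obtain ⟨e, b, hs, ⟨m, hm, he⟩, hb⟩ := ha
    obtain ⟨f, hf⟩ := exists_psum (inf_le_left : e ⊓ (r ⊓ s) ≤ e)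
    obtain ⟨u, hu, hu'⟩ := hf.assoc hs
    obtain ⟨g, hg, hgε⟩ := h.mono (inf_le_left : r ⊓ s ≤ r) (inf_le_right : r ⊓ s ≤ s)
    have hge := hgε.trans he
    refine ⟨_, u, hu', ⟨m, hm, ?_⟩, f, b, hu, ⟨m, hm, ?_⟩, ih hb⟩
    · have := inf_oplus_le (r ⊓ s) e m
      rw [inf_eq_left.2 (hg.le_left.trans hge), inf_comm _ e] at this
      exact this.trans (oplus_mono le_rfl inf_le_right)
    · refine hg.le_of_le_oplus (hge.trans ?_)
      rw [← hf.oplus_eq, oplus_assoc]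
      exact oplus_mono inf_le_right le_rfl

theorem IsMVMaximal.inf_notMem (hM : IsMVMaximal M) {r s : E} (hr : r ∉ M) (hs : s ∉ M) :
    r ⊓ s ∉ M := by
  intro h
  obtain ⟨p, hp⟩ := exists_psum (inf_le_left : r ⊓ s ≤ r)
  obtain ⟨q, hq⟩ := exists_psum (inf_le_right : r ⊓ s ≤ s)
  rcases hM.mem_or_mem (inf_eq_zero_of_psum_inf hp hq) with h' | h'
  · exact hr (hM.mem_of_psum hp h h')
  · exact hs (hM.mem_of_psum hq h h')

theorem IsMVMaximal.exists_count_of_covers (hM : IsMVMaximal M) (hε : ε ∉ M) {r : ℕ}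
    (hr : ∀ a q, PSum (a ⊓ ε) q ε → q ∉ M → Covers M ε r a) :
    ∃ N : E → ℕ, (∀ a, Fits M ε (N a) a) ∧ (∀ a ∈ M, N a = 0) ∧
      (∀ a k, Fits M ε k a → k ≤ N a + r) ∧
      ∀ a b c, PSum a b c → N a + N b ≤ N c + r ∧ N c ≤ N a + N b + 2 * r := by
  obtain ⟨K, hK⟩ := hM.covers hε
  choose N hN hN' using fun a => exists_fits_covers hM.toIsMVIdeal hr (hK a)
  refine ⟨N, hN, fun a ha => Nat.le_zero.1 ((hN a).le_of_covers hM.toIsMVIdeal hε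
    ⟨a, ha, le_oplus_right _ _⟩), fun a k hk => hk.le_of_covers hM.toIsMVIdeal hε (hN' a),
    fun a b c h => ⟨?_, ?_⟩⟩
  · exact ((hN a).add (hN b) h).le_of_covers hM.toIsMVIdeal hε (hN' c)
  · have := (hN c).le_of_covers hM.toIsMVIdeal hε ((hN' a).add hM.toIsMVIdeal (hN' b) h)
    omega

/-- Approximately additive counting functions on an MV-effect algebra modulo a maximal ideal. -/
theorem IsMVMaximal.exists_count (hM : IsMVMaximal M) (n : ℕ) :
    ∃ N : E → ℕ, 0 < N 1 ∧ (∀ a ∈ M, N a = 0) ∧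
      ∀ a b c, PSum a b c → n * (N a + N b) ≤ n * N c + N 1 ∧
        n * N c ≤ n * (N a + N b) + 2 * N 1 := by
  -- If `ε` is an atom modulo `M`, division leaves no remainder and counting is exactly additive (`r
  -- = 0`). Otherwise the remainder costs at most one copy (`r = 1`), and halving makes `N 1` exceed
  -- `n`.
  by_cases hatom : ∃ ε, ε ∉ M ∧ ∀ r s, PSum r s ε → r ∈ M ∨ s ∈ M
  · obtain ⟨ε, hε, hat⟩ := hatom
    obtain ⟨N, h1, h2, h3, h4⟩ := hM.exists_count_of_covers hε (r := 0) (by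
      intro a q hq hqM
      obtain ⟨p, hp⟩ := exists_psum (inf_le_left : a ⊓ ε ≤ a)
      refine ⟨a, ?_, le_oplus_right _ _⟩
      rcases hM.mem_or_mem (inf_eq_zero_of_psum_inf hp hq) with h | h
      · exact hM.mem_of_psum hp ((hat _ _ hq).resolve_right hqM) h
      · exact absurd h hqM)
    refine ⟨N, ?_, h2, fun a b c h => ?_⟩
    · obtain ⟨d, hd⟩ := exists_psum (le_one' ε)
      exact h3 1 1 ⟨ε, d, hd, ⟨0, hM.zero_mem, le_oplus_left _ _⟩, trivial⟩
    · obtain ⟨h5, h6⟩ := h4 a b c h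
      have h5' := Nat.mul_le_mul_left n h5
      have h6' := Nat.mul_le_mul_left n h6
      rw [Nat.mul_zero, Nat.add_zero] at h6'
      rw [Nat.add_zero] at h5'
      omega
  · push Not at hatom
    have key : ∀ k, ∃ ε, ε ∉ M ∧ Fits M ε (k + 1) 1 := by
      intro k
      induction k with
      | zero =>
        exact ⟨1, hM.one_notMem, 1, 0, psum_zero 1, ⟨0, hM.zero_mem, le_oplus_left _ _⟩, trivial⟩
      | succ k ih =>
        obtain ⟨ε, hε, hk⟩ := ih
        obtain ⟨r, s, h, hr, hs⟩ := hatom ε hε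
        have hf := Fits.half h hk
        refine ⟨r ⊓ s, hM.inf_notMem hr hs, ?_⟩
        -- Halving yields `2 (k + 1)` copies; the surplus `k` is discarded.
        have : ∀ j l, Fits M (r ⊓ s) (l + j) 1 → Fits M (r ⊓ s) l 1 := by
          intro j l
          induction j with
          | zero => exact id
          | succ j ih => exact fun h => ih h.of_succ
        exact this k _ (by convert hf using 1; ring)
    obtain ⟨ε, hε, hk⟩ := key (n + 1)
    obtain ⟨N, h1, h2, h3, h4⟩ := hM.exists_count_of_covers hε (r := 1) (by
      intro a q hq hqM
      obtain ⟨p, hp⟩ := exists_psum (inf_le_left : a ⊓ ε ≤ a)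
      refine ⟨p, (hM.mem_or_mem (inf_eq_zero_of_psum_inf hp hq)).resolve_right hqM, ?_⟩
      rw [onsmul_succ, onsmul_zero, oplus_zero, ← hp.oplus_eq]
      exact oplus_mono inf_le_right le_rfl)
    have hn := h3 1 _ hk
    refine ⟨N, by omega, h2, fun a b c h => ?_⟩
    obtain ⟨h5, h6⟩ := h4 a b c h
    have h5' := Nat.mul_le_mul_left n h5
    have h6' := Nat.mul_le_mul_left n h6
    rw [Nat.mul_add n (N c)] at h5'
    rw [Nat.mul_add n (N a + N b)] at h6'
    omega

end Counting

/-- The homomorphism is a limit of the normalized counts `N n a / N n 1` along an ultrafilter; their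
additivity errors are at most `2 / (n + 1)`. -/
theorem IsMVMaximal.exists_hom {M : Set E} (hM : IsMVMaximal M) :
    ∃ h : E → ℝ, IsMVHom h ∧ ∀ a ∈ M, h a = 0 := by
  choose N hN0 hNM hN using fun n : ℕ => hM.exists_count (n + 1)
  have hpos : ∀ n, (0 : ℝ) < N n 1 := fun n => Nat.cast_pos.2 (hN0 n)
  have hinv : Tendsto (fun n : ℕ => (2 : ℝ) / ((n + 1 : ℕ) : ℝ)) (hyperfilter ℕ : Filter ℕ) (𝓝 0) :=
    ((tendsto_const_div_atTop_nhds_zero_nat 2).comp (tendsto_add_atTop_nat 1)).mono_left Nat.hyperfilter_le_atTop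
  have hbd : ∀ n a, (N n a : ℝ) / N n 1 ∈ Set.Icc (0 : ℝ) 3 := by
    intro n a
    refine ⟨by positivity, (div_le_iff₀ (hpos n)).2 ?_⟩
    have h2 := (hN n a _ _ (psum_compl a)).1
    have h3 : (n + 1) * N n a ≤ (n + 1) * (2 * N n 1) := by
      nlinarith [Nat.zero_le ((n + 1) * N n (compl a)), Nat.zero_le (n * N n 1)]
    have h4 : (N n a : ℝ) ≤ 2 * N n 1 := by
      exact_mod_cast Nat.le_of_mul_le_mul_left h3 n.succ_pos
    linarith [hpos n]
  have hlim : ∀ a, ∃ y, Tendsto (fun n => (N n a : ℝ) / N n 1) (hyperfilter ℕ : Filter ℕ)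
      (𝓝 y) := by
    intro a
    obtain ⟨y, -, hy⟩ := isCompact_Icc.ultrafilter_le_nhds
      ((hyperfilter ℕ).map fun n => (N n a : ℝ) / N n 1)
      (le_principal_iff.2 (Filter.mem_map.2 (univ_mem' fun n => hbd n a)))
    exact ⟨y, hy⟩
  choose h hh using hlim
  have hMz : ∀ a ∈ M, h a = 0 := fun a ha =>
    tendsto_nhds_unique (hh a) (by simp only [hNM _ a ha, Nat.cast_zero, zero_div,
      tendsto_const_nhds])
  refine ⟨h, ⟨?_, ?_, ?_, ?_⟩, hMz⟩
  · exact tendsto_nhds_unique (hh 1) (by simp only [div_self (hpos _).ne', tendsto_const_nhds])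
  · exact fun a => ge_of_tendsto' (hh a) fun n => (hbd n a).1
  · intro a b c hs
    refine le_antisymm ?_ ?_
    · have := ((hh a).add (hh b)).add hinv
      rw [add_zero] at this
      refine le_of_tendsto_of_tendsto (hh c) this (Eventually.of_forall fun n => ?_)
      have h2 : ((n + 1 : ℕ) * N n c : ℝ) ≤ (n + 1 : ℕ) * (N n a + N n b) + 2 * N n 1 := by
        exact_mod_cast (hN n a b c hs).2
      have hn' : (0 : ℝ) < (n + 1 : ℕ) := Nat.cast_pos.2 n.succ_pos
      have := hpos n
      simp only
      field_simp
      linarith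
    · have := (hh c).add hinv
      rw [add_zero] at this
      refine le_of_tendsto_of_tendsto ((hh a).add (hh b)) this (Eventually.of_forall fun n => ?_)
      have h2 : ((n + 1 : ℕ) * (N n a + N n b) : ℝ) ≤ (n + 1 : ℕ) * N n c + N n 1 := by
        exact_mod_cast (hN n a b c hs).1
      have hn' : (0 : ℝ) < (n + 1 : ℕ) := Nat.cast_pos.2 n.succ_pos
      have := hpos n
      simp only
      field_simp
      linarith
  · intro a b hab
    exact (hM.mem_or_mem hab).imp (hMz a) (hMz b)

/-- Choose `n` with `n c ≰ c'` and let `w`, `z` be the disjoint differences of `n c`, `c'` with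
their meet. A maximal ideal containing the polar of `w` contains `z`; if it also contained `c`, it
would contain `n c`, then `c'`, then `1`. -/
theorem exists_isMVHom_pos {c : E} (hc : c ≠ 0) : ∃ h : E → ℝ, IsMVHom h ∧ 0 < h c := by
  obtain ⟨n, hn⟩ := exists_not_onsmul_le_compl hc
  obtain ⟨w, hw⟩ := exists_psum (inf_le_left : onsmul n c ⊓ compl c ≤ onsmul n c)
  obtain ⟨z, hz⟩ := exists_psum (inf_le_right : onsmul n c ⊓ compl c ≤ compl c)
  have hw0 : w ≠ 0 := by
    rintro rfl
    exact hn (inf_eq_left.1 ((psum_zero _).unique hw))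
  have hI : IsMVIdeal {x | w ⊓ x = 0} :=
    ⟨eq_zero_of_le inf_le_right,
      fun a b hab hb => eq_zero_of_le (hb ▸ inf_le_inf_left w hab),
      fun a b => inf_oplus_eq_zero⟩
  obtain ⟨M, hIM, hM⟩ := hI.exists_maximal (fun h => hw0 ((inf_eq_left.2 (le_one' w)).symm.trans h))
  have hcM : c ∉ M := by
    intro hcM
    have hnc : ∀ n, onsmul n c ∈ M := by
      intro n
      induction n with
      | zero => exact hM.zero_mem
      | succ n ih => rw [onsmul_succ]; exact hM.oplus_mem _ _ hcM ih
    have h1 := hM.mem_of_psum hz (hM.mem_of_le _ _ inf_le_left (hnc n))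
      (hIM (inf_eq_zero_of_psum_inf hw hz))
    exact hM.one_notMem (hM.mem_of_psum (psum_compl c) hcM h1)
  obtain ⟨h, hh, hhM⟩ := hM.exists_hom
  refine ⟨h, hh, (hh.nonneg c).lt_of_ne fun h0 => ?_⟩
  obtain ⟨k, m, hm, h1⟩ := hM.exists_eq_one c hcM
  have hk : ∀ k, h (onsmul k c) = 0 := by
    intro k
    induction k with
    | zero => exact hh.map_zero
    | succ k ih => rw [onsmul_succ, hh.map_oplus, ih, ← h0]; simp
  have := hh.map_one
  rw [← h1, hh.map_oplus, hk, hhM m hm] at this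
  simp at this

end Hom

end EffectAlgebra

/-! ### The space of homomorphisms and generic evaluation. -/

namespace EffectAlgebra

section Representation

variable (E : Type*) [SigmaMVEffectAlgebra E]

/-- The compact space of homomorphisms to the real unit interval. -/
abbrev HomSpace : Type _ := {h : E → ℝ // IsMVHom h}

theorem isClosed_isMVHom : IsClosed {h : E → ℝ | IsMVHom h} := by
  have : {h : E → ℝ | IsMVHom h} = {h | h 1 = 1} ∩ (⋂ a, {h | 0 ≤ h a}) ∩
      (⋂ (a : E) (b : E) (c : E) (_ : PSum a b c), {h | h c = h a + h b}) ∩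
      ⋂ (a : E) (b : E) (_ : a ⊓ b = 0), ({h | h a = 0} ∪ {h | h b = 0}) := by
    ext h
    simp only [Set.mem_ofPred_eq, Set.mem_inter_iff, Set.mem_iInter, Set.mem_union]
    exact ⟨fun hh => ⟨⟨⟨hh.1, hh.2⟩, hh.3⟩, hh.4⟩, fun hh => ⟨hh.1.1.1, hh.1.1.2, hh.1.2, hh.2⟩⟩
  rw [this]
  refine (((isClosed_eq (continuous_apply _) continuous_const).inter
    (isClosed_iInter fun a => isClosed_le continuous_const (continuous_apply a))).inter ?_).inter ?_
  · exact isClosed_iInter fun a => isClosed_iInter fun b => isClosed_iInter fun c =>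
      isClosed_iInter fun _ => isClosed_eq (continuous_apply c)
        ((continuous_apply a).add (continuous_apply b))
  · exact isClosed_iInter fun a => isClosed_iInter fun b => isClosed_iInter fun _ =>
      (isClosed_eq (continuous_apply a) continuous_const).union
        (isClosed_eq (continuous_apply b) continuous_const)

instance : CompactSpace (HomSpace E) := by
  refine isCompact_iff_compactSpace.1 ((isCompact_univ_pi fun _ : E =>
    (isCompact_Icc : IsCompact (Set.Icc (0 : ℝ) 1))).of_isClosed_subset (isClosed_isMVHom E) ?_)
  exact fun h hh a _ => ⟨hh.nonneg a, hh.le_one a⟩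

variable {E}

theorem continuous_eval (a : E) : Continuous fun h : HomSpace E => h.1 a :=
  (continuous_apply a).comp continuous_subtype_val

theorem le_of_forall_hom {a b : E} (hab : ∀ h : HomSpace E, h.1 a ≤ h.1 b) : a ≤ b := by
  obtain ⟨p, hp⟩ := exists_psum (inf_le_left : a ⊓ b ≤ a)
  by_cases h0 : p = 0
  · rw [h0] at hp
    exact inf_eq_left.1 ((psum_zero _).unique hp)
  · obtain ⟨h, hh, hpos⟩ := exists_isMVHom_pos h0
    have h1 := hh.map_psum _ _ _ hp
    rw [hh.map_inf, min_eq_left (hab ⟨h, hh⟩)] at h1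
    linarith

/-- Inequalities may be checked at generic homomorphisms. -/
theorem le_of_eventually {a b : E} (hab : ∀ᶠ h in residual (HomSpace E), h.1 a ≤ h.1 b) :
    a ≤ b := by
  refine le_of_forall_hom fun h => ?_
  have hcl : IsClosed {h : HomSpace E | h.1 a ≤ h.1 b} :=
    isClosed_le (continuous_eval a) (continuous_eval b)
  -- Baire's theorem in a compact Hausdorff space.
  have hd : Dense {h : HomSpace E | h.1 a ≤ h.1 b} := dense_of_mem_residual hab
  have := hd.closure_eq
  rw [hcl.closure_eq] at this
  exact this.ge (Set.mem_univ h)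

theorem eq_of_eventually {a b : E} (hab : ∀ᶠ h in residual (HomSpace E), h.1 a = h.1 b) :
    a = b :=
  le_antisymm (le_of_eventually (hab.mono fun _ h => h.le))
    (le_of_eventually (hab.mono fun _ h => h.ge))

/-- Inductively, the clamp for `(n + 1, k)` is the one for `(n, k)` plus the Łukasiewicz product of
`a` with the one for `(n, k - 1)`. Its purpose: `h a > k / n` becomes positivity of `h` at an
element. -/
theorem exists_clamp (a : E) (n : ℕ) (k : ℤ) :
    ∃ c : E, ∀ h, IsMVHom h → h c = max 0 (min 1 (n * h a - k)) := by
  induction n generalizing k with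
  | zero =>
    rcases le_or_gt 0 k with hk | hk
    · refine ⟨0, fun h hh => ?_⟩
      have : (0 : ℝ) ≤ k := Int.cast_nonneg hk
      rw [hh.map_zero, max_eq_left]
      exact (min_le_right _ _).trans (by push_cast; linarith)
    · refine ⟨1, fun h hh => ?_⟩
      have : (k : ℝ) ≤ -1 := by exact_mod_cast Int.le_sub_one_of_lt hk
      rw [hh.map_one, min_eq_left (by push_cast; linarith), max_eq_right zero_le_one]
  | succ n ih =>
    obtain ⟨c₁, h₁⟩ := ih k
    obtain ⟨c₂, h₂⟩ := ih (k - 1)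
    refine ⟨oplus c₁ (compl (oplus (compl a) (compl c₂))), fun h hh => ?_⟩
    rw [hh.map_oplus, hh.map_compl, hh.map_oplus, hh.map_compl, hh.map_compl, h₁ h hh, h₂ h hh]
    push_cast
    have ha := hh.nonneg a
    have ha' := hh.le_one a
    generalize h a = x at *
    rw [add_mul, one_mul]
    generalize (n : ℝ) * x = y at *
    generalize (k : ℝ) = z at *
    simp only [max_def, min_def]
    split_ifs <;> linarith

/-- The sets `{h | 0 < h c}` form a base of the topology of the space of homomorphisms. -/
theorem exists_pos_subset_of_mem_nhds {h₀ : HomSpace E} {U : Set (HomSpace E)} (hU : U ∈ 𝓝 h₀) :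
    ∃ c : E, 0 < h₀.1 c ∧ {h : HomSpace E | 0 < h.1 c} ⊆ U := by
  set F : Filter (HomSpace E) := ⨅ c ∈ {c : E | 0 < h₀.1 c}, 𝓟 {h | 0 < h.1 c} with hF
  have hbasis : F.HasBasis (fun c => 0 < h₀.1 c) fun c => {h | 0 < h.1 c} := by
    refine hasBasis_biInf_principal ?_ ⟨1, by rw [Set.mem_ofPred_eq, h₀.2.map_one]; exact one_pos⟩
    intro a ha b hb
    refine ⟨a ⊓ b, ?_, ?_, ?_⟩
    · rw [Set.mem_ofPred_eq, h₀.2.map_inf]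
      exact lt_min ha hb
    · exact fun h hh => hh.trans_le (h.2.mono inf_le_left)
    · exact fun h hh => hh.trans_le (h.2.mono inf_le_right)
  have hlower : ∀ (a : E) (y : ℝ), y < h₀.1 a → ∀ᶠ h : HomSpace E in F, y < h.1 a := by
    intro a y hy
    obtain ⟨q, hq, hq'⟩ := exists_rat_btwn hy
    obtain ⟨c, hc⟩ := exists_clamp a q.den q.num
    have hden : (0 : ℝ) < q.den := Nat.cast_pos.2 q.den_pos
    have hqe : (q.num : ℝ) = q.den * q := by
      have := Rat.den_mul_eq_num q
      exact_mod_cast this.symm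
    have key : ∀ h, IsMVHom h → (0 < h c ↔ (q : ℝ) < h a) := by
      intro h hh
      rw [hc h hh, lt_max_iff, lt_min_iff, hqe, ← mul_sub, mul_pos_iff_of_pos_left hden, sub_pos]
      simp
    exact hbasis.mem_iff.2 ⟨c, (key _ h₀.2).2 hq', fun h hh => hq.trans ((key _ h.2).1 hh)⟩
  have hle : F ≤ 𝓝 h₀ := by
    have : Tendsto (fun h : HomSpace E => h) F (𝓝 h₀) := by
      rw [tendsto_subtype_rng, tendsto_pi_nhds]
      refine fun a => tendsto_order.2 ⟨hlower a, fun y hy => ?_⟩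
      -- Upper bounds at `a` are lower bounds at its complement.
      refine (hlower (compl a) (1 - y) (by rw [h₀.2.map_compl]; linarith)).mono fun h hh => ?_
      rw [h.2.map_compl] at hh
      linarith
    exact this
  exact hbasis.mem_iff.1 (hle hU)

/-- The differences `e i = s ⊖ a i` have infimum `0`, and `x ⊖ (x ∧ u)` is below all of them. -/
theorem le_of_forall_le_oplus {ι : Type*} [Nonempty ι] {a e : ι → E} {s : E}
    (hs : IsLUB (Set.range a) s) (he : ∀ i, PSum (a i) (e i) s) {x u : E}
    (h : ∀ i, x ≤ oplus (e i) u) : x ≤ u := by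
  obtain ⟨d, hd⟩ := exists_psum (inf_le_left : x ⊓ u ≤ x)
  have hde : ∀ i, d ≤ e i := fun i => (psum_sup_of_psum_inf hd).le_of_le_oplus
    (sup_le (oplus_comm u (e i) ▸ h i) (le_oplus_left _ _))
  obtain ⟨i⟩ := ‹Nonempty ι›
  obtain ⟨v, hv⟩ := exists_psum ((hde i).trans (he i).le_right)
  have hsv : s ≤ v := by
    refine hs.2 ?_
    rintro _ ⟨j, rfl⟩
    exact hv.le_of_le (he j).comm (hde j)
  rw [le_antisymm hv.le_right hsv] at hv
  rw [hv.comm.eq_zero_of_eq] at hd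
  exact inf_eq_left.1 ((psum_zero _).unique hd)

/-- Suprema are pointwise suprema at generic homomorphisms. -/
theorem eventually_isLUB {ι : Type*} [Nonempty ι] {a : ι → E} {s : E}
    (hs : IsLUB (Set.range a) s) :
    ∀ᶠ h in residual (HomSpace E), IsLUB (Set.range fun i => h.1 (a i)) (h.1 s) := by
  choose e he using fun i => exists_psum (hs.1 ⟨i, rfl⟩)
  -- The failure of the pointwise supremum is a countable union of closed sets, one for each gap `1
  -- / (K + 1)`; each is shown to have empty interior.
  have hK : ∀ K : ℕ, ∀ᶠ h in residual (HomSpace E),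
      ¬ ∀ i, h.1 (a i) + 1 / ((K : ℝ) + 1) ≤ h.1 s := by
    intro K
    set F : Set (HomSpace E) := {h | ∀ i, h.1 (a i) + 1 / ((K : ℝ) + 1) ≤ h.1 s} with hF
    have hcl : IsClosed F := by
      rw [hF, Set.ofPred_forall]
      exact isClosed_iInter fun i =>
        isClosed_le ((continuous_eval (a i)).add continuous_const) (continuous_eval s)
    refine residual_of_dense_open hcl.isOpen_compl (interior_eq_empty_iff_dense_compl.1 ?_)
    refine Set.eq_empty_iff_forall_notMem.2 fun h₀ h₀F => ?_
    obtain ⟨c, hc, hcF⟩ := exists_pos_subset_of_mem_nhds (mem_interior_iff_mem_nhds.1 h₀F)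
    -- On `F` every `e i` has value at least `1 / (K + 1)`, so any `K + 1` of them add up to `1`.
    have hsum : ∀ l : List ι, ∀ h ∈ F,
        min 1 ((l.length : ℝ) * (1 / ((K : ℝ) + 1))) ≤ h.1 (l.foldr (fun i => oplus (e i)) 0) := by
      intro l h hh
      induction l with
      | nil => simp [h.2.map_zero]
      | cons i l ih =>
        rw [List.foldr_cons, h.2.map_oplus, List.length_cons]
        have h1 := hh i
        have h2 := h.2.map_psum _ _ _ (he i)
        refine le_min (min_le_left _ _) ?_
        push_cast
        rcases min_le_iff.1 ih with h3 | h3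
        · exact (min_le_left _ _).trans (by linarith [h.2.nonneg (e i)])
        · exact (min_le_right _ _).trans (by linarith)
    have hbound : ∀ l : List ι, l.length = K + 1 → c ≤ l.foldr (fun i => oplus (e i)) 0 := by
      intro l hl
      refine le_of_forall_hom fun h => ?_
      rcases (h.2.nonneg c).eq_or_lt with h0 | h0
      · rw [← h0]
        exact h.2.nonneg _
      · refine (h.2.le_one c).trans (le_trans (le_of_eq ?_) (hsum l h (hcF h0)))
        rw [hl]
        push_cast
        rw [mul_one_div_cancel (by positivity), min_self]
    -- Letting only the head index vary, `le_of_forall_le_oplus` removes one summand at a time.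
    have hdesc : ∀ k, (∀ l : List ι, l.length = k → c ≤ l.foldr (fun i => oplus (e i)) 0) →
        c ≤ 0 := by
      intro k
      induction k with
      | zero => exact fun h => h [] rfl
      | succ k ih =>
        refine fun h => ih fun l hl => le_of_forall_le_oplus hs he fun i => ?_
        exact h (i :: l) (by rw [List.length_cons, hl])
    rw [eq_zero_of_le (hdesc _ hbound), h₀.2.map_zero] at hc
    exact hc.false
  filter_upwards [eventually_countable_forall.2 hK] with h hh
  refine ⟨?_, fun y hy => ?_⟩
  · rintro _ ⟨i, rfl⟩
    exact h.2.mono (hs.1 ⟨i, rfl⟩)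
  · by_contra! hlt
    obtain ⟨K, hK⟩ := exists_nat_one_div_lt (sub_pos.2 hlt)
    refine hh K fun i => ?_
    have : h.1 (a i) ≤ y := hy ⟨i, rfl⟩
    linarith

theorem isLUB_of_eventually {a : ℕ → E} {s : E}
    (hs : ∀ᶠ h in residual (HomSpace E), IsLUB (Set.range fun n => h.1 (a n)) (h.1 s)) :
    IsLUB (Set.range a) s := by
  obtain ⟨t, ht⟩ := SigmaMVEffectAlgebra.exists_isLUB_range a
  have : s = t := eq_of_eventually (by
    filter_upwards [hs, eventually_isLUB ht] with h h1 h2 using h1.unique h2)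
  exact this ▸ ht

theorem inf_le_of_isLUB {ι : Type*} [Nonempty ι] {a : ι → E} {s b t : E}
    (hs : IsLUB (Set.range a) s) (h : ∀ i, b ⊓ a i ≤ t) : b ⊓ s ≤ t := by
  refine le_of_eventually ?_
  filter_upwards [eventually_isLUB hs] with f hf
  rw [f.2.map_inf]
  by_contra! hlt
  obtain ⟨_, ⟨i, rfl⟩, hi⟩ := (lt_isLUB_iff hf).1 (hlt.trans_le (min_le_right _ _))
  have := f.2.mono (h i)
  rw [f.2.map_inf] at this
  exact absurd (lt_min (hlt.trans_le (min_le_left _ _)) hi) this.not_gt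

end Representation

end EffectAlgebra

/-! ### Observables are determined by rational half-lines. -/

namespace Observable

open EffectAlgebra

theorem psum_union {E : Type*} [EffectAlgebra E] (x : Observable E) {A B : Set ℝ}
    (hA : MeasurableSet A) (hB : MeasurableSet B) (h : Disjoint A B) :
    PSum (x.toFun ⟨A, hA⟩) (x.toFun ⟨B, hB⟩) (x.toFun ⟨A ∪ B, hA.union hB⟩) :=
  x.map_union A B hA hB h.inter_eq

theorem mono {E : Type*} [EffectAlgebra E] (x : Observable E) {A B : Set ℝ}
    (hA : MeasurableSet A) (hB : MeasurableSet B) (h : A ⊆ B) :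
    x.toFun ⟨A, hA⟩ ≤ x.toFun ⟨B, hB⟩ := by
  have := (x.psum_union hA (hB.diff hA) Set.disjoint_sdiff_right).le_left
  simpa only [Set.union_sdiff_cancel h] using this

/-- An observable is determined by its values at the half-lines with rational end points. -/
theorem ext_spectral {E : Type*} [EffectAlgebra E] {x y : Observable E}
    (h : ∀ q : ℚ, x.spectral q = y.spectral q) : x = y := by
  have key : ∀ (A : Set ℝ) (hA : MeasurableSet A), x.toFun ⟨A, hA⟩ = y.toFun ⟨A, hA⟩ := by
    intro A hA
    have hempty : ∀ z : Observable E, z.toFun ⟨∅, MeasurableSet.empty⟩ = 0 := by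
      intro z
      have := z.psum_union MeasurableSet.univ MeasurableSet.empty (Set.disjoint_empty _)
      simp only [Set.union_empty] at this
      exact this.eq_zero_of_eq
    induction A, hA using MeasurableSpace.induction_on_inter
      (BorelSpace.measurable_eq.trans Real.borel_eq_generateFrom_Iio_rat)
      Real.isPiSystem_Iio_rat with
    | empty => rw [hempty, hempty]
    | basic t ht =>
      obtain ⟨q, hq⟩ := Set.mem_iUnion.1 ht
      obtain rfl := Set.mem_singleton_iff.1 hq
      exact h q
    | compl t ht ih =>
      have hc : ∀ z : Observable E, z.toFun ⟨tᶜ, ht.compl⟩ = compl (z.toFun ⟨t, ht⟩) := by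
        intro z
        have := z.psum_union ht ht.compl disjoint_compl_right
        simp only [Set.union_compl_self, z.map_univ] at this
        exact this.cancel_left (psum_compl _)
      rw [hc, hc, ih]
    | iUnion f hd hm ih =>
      -- The axioms treat increasing unions only, so the disjoint union is exhausted by finite
      -- partial unions.
      have hmeas : ∀ n, MeasurableSet (⋃ k < n, f k) := fun n =>
        MeasurableSet.biUnion (Set.to_countable _) fun k _ => hm k
      have hpart : ∀ n, x.toFun ⟨⋃ k < n, f k, hmeas n⟩ = y.toFun ⟨⋃ k < n, f k, hmeas n⟩ := by
        intro n
        induction n with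
        | zero => simp only [not_lt_zero, Set.iUnion_of_empty, Set.iUnion_empty, hempty]
        | succ n ihn =>
          have hdis : Disjoint (⋃ k < n, f k) (f n) := by
            simp only [Set.disjoint_iUnion_left]
            exact fun k hk => hd hk.ne
          have h1 := x.psum_union (hmeas n) (hm n) hdis
          have h2 := y.psum_union (hmeas n) (hm n) hdis
          rw [ihn, ih n] at h1
          simpa only [Set.biUnion_lt_succ] using h1.unique h2
      have hU : (⋃ n, ⋃ k < n, f k) = ⋃ n, f n := by
        ext t
        simp only [Set.mem_iUnion]
        exact ⟨fun ⟨_, k, _, hk⟩ => ⟨k, hk⟩, fun ⟨k, hk⟩ => ⟨k + 1, k, k.lt_succ_self, hk⟩⟩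
      have hmono : ∀ n, (⋃ k < n, f k) ⊆ ⋃ k < n + 1, f k := fun n =>
        Set.biUnion_subset_biUnion_left fun k hk => Nat.lt_succ_of_lt hk
      have h1 := x.map_iUnion _ hmeas hmono
      have h2 := y.map_iUnion _ hmeas hmono
      simp only [hpart] at h1
      simpa only [hU] using h1.unique h2
  ext ⟨A, hA⟩
  exact key A hA

end Observable

theorem MeasureTheory.isLUB_measureReal_iUnion {α : Type*} [MeasurableSpace α] (μ : Measure α)
    [IsFiniteMeasure μ] {A : ℕ → Set α} (hA : Monotone A) :
    IsLUB (Set.range fun n => μ.real (A n)) (μ.real (⋃ n, A n)) :=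
  isLUB_of_tendsto_atTop (fun _ _ hmn => measureReal_mono (hA hmn))
    ((ENNReal.tendsto_toReal (measure_ne_top μ _)).comp (tendsto_measure_iUnion_atTop hA))

/-! ### From generic families of measures to observables. -/

namespace EffectAlgebra

section Extension

variable {E : Type*} [SigmaMVEffectAlgebra E] (μ : HomSpace E → Measure ℝ)

/-- The element `a` represents the function `h ↦ μ h A` at generic homomorphisms `h`. -/
def Represents (a : E) (A : Set ℝ) : Prop := ∀ᶠ h in residual (HomSpace E), (μ h).real A = h.1 a

variable {μ}

theorem Represents.unique {a b : E} {A : Set ℝ} (ha : Represents μ a A) (hb : Represents μ b A) :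
    a = b :=
  eq_of_eventually (by filter_upwards [ha, hb] with f h1 h2 using h1.symm.trans h2)

variable [∀ h, IsProbabilityMeasure (μ h)]

theorem Represents.compl {a : E} {A : Set ℝ} (h : Represents μ a A) (hA : MeasurableSet A) :
    Represents μ (compl a) Aᶜ := by
  filter_upwards [h] with f hf
  rw [f.2.map_compl, ← hf, probReal_compl_eq_one_sub hA]

theorem Represents.union {a b : E} {A B : Set ℝ} (ha : Represents μ a A) (hb : Represents μ b B)
    (hB : MeasurableSet B) (hd : Disjoint A B) : ∃ c, PSum a b c ∧ Represents μ c (A ∪ B) := by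
  have hadd : ∀ h, (μ h).real (A ∪ B) = (μ h).real A + (μ h).real B :=
    fun h => measureReal_union hd hB
  obtain ⟨c, hc⟩ := exists_psum_of_le_compl (a := a) (b := b) (le_of_eventually (by
    filter_upwards [ha, hb] with f h1 h2
    rw [f.2.map_compl, ← h1, ← h2]
    have := hadd f
    have h3 : (μ f).real (A ∪ B) ≤ 1 := measureReal_le_one
    linarith))
  refine ⟨c, hc, ?_⟩
  filter_upwards [ha, hb] with f h1 h2
  rw [hadd, h1, h2, f.2.map_psum _ _ _ hc]

theorem Represents.isLUB {a : ℕ → E} {A : ℕ → Set ℝ} (h : ∀ n, Represents μ (a n) (A n))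
    (hA : Monotone A) {s : E} (hs : Represents μ s (⋃ n, A n)) : IsLUB (Set.range a) s := by
  refine isLUB_of_eventually ?_
  filter_upwards [hs, eventually_countable_forall.2 h] with f h1 h2
  rw [← h1]
  simp only [← h2]
  exact isLUB_measureReal_iUnion _ hA

theorem Represents.iUnion {a : ℕ → E} {A : ℕ → Set ℝ} (h : ∀ n, Represents μ (a n) (A n))
    (hA : Monotone A) : ∃ s, Represents μ s (⋃ n, A n) := by
  obtain ⟨s, hs⟩ := SigmaMVEffectAlgebra.exists_isLUB_range a
  refine ⟨s, ?_⟩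
  filter_upwards [eventually_isLUB hs, eventually_countable_forall.2 h] with f h1 h2
  simp only [← h2] at h1
  exact (isLUB_measureReal_iUnion _ hA).unique h1

/-- Represented sets form a Dynkin system; closure under increasing unions combines σ-completeness
of `E` with `eventually_isLUB`. -/
theorem exists_represents (hμ : ∀ q : ℚ, ∃ a, Represents μ a (Set.Iio (q : ℝ))) (A : Set ℝ)
    (hA : MeasurableSet A) : ∃ a, Represents μ a A := by
  have hempty : Represents μ 0 ∅ := Eventually.of_forall fun f => by
    rw [f.2.map_zero, measureReal_empty]
  induction A, hA using MeasurableSpace.induction_on_inter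
    (BorelSpace.measurable_eq.trans Real.borel_eq_generateFrom_Iio_rat)
    Real.isPiSystem_Iio_rat with
  | empty => exact ⟨0, hempty⟩
  | basic t ht =>
    obtain ⟨q, hq⟩ := Set.mem_iUnion.1 ht
    obtain rfl := Set.mem_singleton_iff.1 hq
    exact hμ q
  | compl t ht ih => exact ih.elim fun a ha => ⟨_, Represents.compl ha ht⟩
  | iUnion f hd hm ih =>
    have hpart : ∀ n, ∃ a, Represents μ a (⋃ k < n, f k) := by
      intro n
      induction n with
      | zero => exact ⟨0, by simpa only [not_lt_zero, Set.iUnion_of_empty, Set.iUnion_empty]⟩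
      | succ n ihn =>
        obtain ⟨a, ha⟩ := ihn
        obtain ⟨b, hb⟩ := ih n
        have hdis : Disjoint (⋃ k < n, f k) (f n) := by
          simp only [Set.disjoint_iUnion_left]
          exact fun k hk => hd hk.ne
        obtain ⟨c, -, hc⟩ := ha.union hb (hm n) hdis
        exact ⟨c, by rwa [Set.biUnion_lt_succ]⟩
    choose a ha using hpart
    have hmono : Monotone fun n => ⋃ k < n, f k := fun m n hmn =>
      Set.biUnion_subset_biUnion_left fun k hk => lt_of_lt_of_le hk hmn
    have hU : (⋃ n, ⋃ k < n, f k) = ⋃ n, f n := by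
      ext t
      simp only [Set.mem_iUnion]
      exact ⟨fun ⟨_, k, _, hk⟩ => ⟨k, hk⟩, fun ⟨k, hk⟩ => ⟨k + 1, k, k.lt_succ_self, hk⟩⟩
    exact hU ▸ Represents.iUnion ha hmono

/-- A family of probability measures which is represented at half-lines yields an observable. -/
theorem exists_observable (hμ : ∀ q : ℚ, ∃ a, Represents μ a (Set.Iio (q : ℝ))) :
    ∃ x : Observable E, ∀ A : {A : Set ℝ // MeasurableSet A}, Represents μ (x.toFun A) A := by
  choose x hx using fun A : {A : Set ℝ // MeasurableSet A} => exists_represents hμ A.1 A.2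
  refine ⟨⟨x, ?_, ?_, ?_⟩, hx⟩
  · refine (hx _).unique (Eventually.of_forall fun f => ?_)
    rw [f.2.map_one, probReal_univ]
  · intro A B hA hB hd
    obtain ⟨c, hc, hc'⟩ := (hx ⟨A, hA⟩).union (hx ⟨B, hB⟩) hB (Set.disjoint_iff_inter_eq_empty.2 hd)
    rw [(hx ⟨A ∪ B, hA.union hB⟩).unique hc']
    exact hc
  · intro A hA hm
    exact Represents.isLUB (fun n => hx ⟨A n, hA n⟩) (monotone_nat_of_le_succ hm) (hx _)

end Extension

/-! ### From spectral resolutions to observables. -/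

section Spectral

variable {E : Type*} [SigmaMVEffectAlgebra E]

/-- Bounded spectral resolutions: left continuous functions attaining `0` and `1`. -/
structure IsSpectral (B : ℝ → E) : Prop where
  isLUB : ∀ t : ℝ, IsLUB (Set.range fun r : {r : ℚ // (r : ℝ) < t} => B (r : ℚ)) (B t)
  exists_eq_zero : ∃ α, B α = 0
  exists_eq_one : ∃ β, B β = 1

instance (t : ℝ) : Nonempty {r : ℚ // (r : ℝ) < t} :=
  (exists_rat_lt t).elim fun r hr => ⟨⟨r, hr⟩⟩

theorem IsSpectral.monotone {B : ℝ → E} (hB : IsSpectral B) : Monotone B := by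
  intro s t hst
  refine (hB.isLUB s).2 ?_
  rintro _ ⟨r, rfl⟩
  exact (hB.isLUB t).1 ⟨⟨r.1, r.2.trans_le hst⟩, rfl⟩

/-- The quantile function of the distribution function `h ∘ B`. -/
noncomputable def quantile (B : ℝ → E) (h : HomSpace E) (s : ℝ) : ℝ :=
  sSup ((fun q : ℚ => (q : ℝ)) '' {q : ℚ | h.1 (B q) ≤ s})

namespace IsSpectral

variable {B : ℝ → E} (hB : IsSpectral B)
include hB

theorem bddAbove_quantile (h : HomSpace E) {s : ℝ} (hs : s < 1) :
    BddAbove ((fun q : ℚ => (q : ℝ)) '' {q : ℚ | h.1 (B q) ≤ s}) := by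
  obtain ⟨β, hβ⟩ := hB.exists_eq_one
  refine ⟨β, ?_⟩
  rintro _ ⟨q, hq, rfl⟩
  by_contra! hlt
  have h1 := h.2.mono (hB.monotone hlt.le)
  rw [hβ, h.2.map_one] at h1
  exact absurd (h1.trans hq) hs.not_ge

theorem nonempty_quantile (h : HomSpace E) {s : ℝ} (hs : 0 ≤ s) :
    ((fun q : ℚ => (q : ℝ)) '' {q : ℚ | h.1 (B q) ≤ s}).Nonempty := by
  obtain ⟨α, hα⟩ := hB.exists_eq_zero
  obtain ⟨q, hq⟩ := exists_rat_lt α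
  refine ⟨q, q, ?_, rfl⟩
  have h1 := h.2.mono (hB.monotone hq.le)
  rw [hα, h.2.map_zero] at h1
  exact h1.trans hs

theorem aemeasurable_quantile (h : HomSpace E) :
    AEMeasurable (quantile B h) (volume.restrict (Set.Ico 0 1)) := by
  refine aemeasurable_restrict_of_monotoneOn measurableSet_Ico fun s hs t ht hst => ?_
  exact csSup_le_csSup (hB.bddAbove_quantile h ht.2) (hB.nonempty_quantile h hs.1)
    (Set.image_mono fun q hq => le_trans hq hst)

/-- Every bounded spectral resolution is the spectral resolution of an observable. -/
theorem exists_observable : ∃ x : Observable E, ∀ q : ℚ, x.spectral q = B q := by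
  have hprob : IsProbabilityMeasure (volume.restrict (Set.Ico (0 : ℝ) 1)) := ⟨by simp⟩
  -- Restricting to `[0, 1)` keeps the suprema defining `quantile` over nonempty bounded sets.
  let μ : HomSpace E → Measure ℝ := fun h => (volume.restrict (Set.Ico 0 1)).map (quantile B h)
  have hμ : ∀ h, IsProbabilityMeasure (μ h) := fun h =>
    Measure.isProbabilityMeasure_map (hB.aemeasurable_quantile h)
  have hrep : ∀ q : ℚ, Represents μ (B q) (Set.Iio (q : ℝ)) := by
    intro q
    filter_upwards [eventually_isLUB (hB.isLUB q)] with h hh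
    -- The quantile at `s` is below `q` exactly when `s < h (B q)`; the backward direction uses left
    -- continuity of `h ∘ B` at `q`, which is where genericity enters.
    have hset : quantile B h ⁻¹' Set.Iio (q : ℝ) ∩ Set.Ico 0 1 = Set.Ico 0 (h.1 (B q)) := by
      ext s
      simp only [Set.mem_inter_iff, Set.mem_preimage, Set.mem_Iio, Set.mem_Ico]
      constructor
      · rintro ⟨h1, h2, h3⟩
        refine ⟨h2, ?_⟩
        by_contra! hle
        exact absurd (le_csSup (hB.bddAbove_quantile h h3) ⟨q, hle, rfl⟩) h1.not_ge
      · rintro ⟨h1, h2⟩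
        refine ⟨?_, h1, h2.trans_le (h.2.le_one _)⟩
        obtain ⟨_, ⟨r, rfl⟩, hr⟩ := (lt_isLUB_iff hh).1 h2
        refine lt_of_le_of_lt (csSup_le (hB.nonempty_quantile h h1) ?_) r.2
        rintro _ ⟨p, hp, rfl⟩
        by_contra! hlt
        exact absurd (hr.trans_le ((h.2.mono (hB.monotone hlt.le)).trans hp)) (lt_irrefl _)
    rw [measureReal_def, Measure.map_apply_of_aemeasurable (hB.aemeasurable_quantile h)
      measurableSet_Iio, Measure.restrict_apply' measurableSet_Ico, hset, Real.volume_Ico,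
      sub_zero, ENNReal.toReal_ofReal (h.2.nonneg _)]
  obtain ⟨x, hx⟩ := EffectAlgebra.exists_observable (μ := μ) fun q => ⟨B q, hrep q⟩
  exact ⟨x, fun q => (hx _).unique (hrep q)⟩

end IsSpectral

end Spectral

end EffectAlgebra

open EffectAlgebra

theorem Observable.isLUB_spectral {E : Type*} [EffectAlgebra E] (x : Observable E) (t : ℝ) :
    IsLUB (Set.range fun r : {r : ℚ // (r : ℝ) < t} => x.spectral (r : ℚ)) (x.spectral t) := by
  constructor
  · rintro _ ⟨r, rfl⟩
    exact x.mono _ _ (Set.Iio_subset_Iio r.2.le)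
  · intro u hu
    have hU : (⋃ n : ℕ, Set.Iio (t - 1 / ((n : ℝ) + 1))) = Set.Iio t := by
      ext s
      simp only [Set.mem_iUnion, Set.mem_Iio]
      constructor
      · rintro ⟨n, hn⟩
        have : (0 : ℝ) < 1 / ((n : ℝ) + 1) := by positivity
        linarith
      · intro hs
        obtain ⟨n, hn⟩ := exists_nat_one_div_lt (sub_pos.2 hs)
        exact ⟨n, by linarith⟩
    have h := x.map_iUnion (fun n : ℕ => Set.Iio (t - 1 / ((n : ℝ) + 1)))
      (fun _ => measurableSet_Iio) fun n => Set.Iio_subset_Iio (by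
        have : 1 / (((n + 1 : ℕ) : ℝ) + 1) ≤ 1 / ((n : ℝ) + 1) :=
          one_div_le_one_div_of_le (by positivity) (by push_cast; linarith)
        linarith)
    simp only [hU] at h
    refine h.2 ?_
    rintro _ ⟨n, rfl⟩
    have hn : t - 1 / ((n : ℝ) + 1) < t := sub_lt_self _ (by positivity)
    obtain ⟨q, hq, hq'⟩ := exists_rat_btwn hn
    exact (x.mono _ _ (Set.Iio_subset_Iio hq.le)).trans (hu ⟨⟨q, hq'⟩, rfl⟩)

/-! ### The sum of two spectral resolutions. -/

namespace EffectAlgebra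

variable {E : Type*} [SigmaMVEffectAlgebra E]

theorem exists_isLUB_of_countable {ι : Type*} [Countable ι] [Nonempty ι] (a : ι → E) :
    ∃ s, IsLUB (Set.range a) s := by
  obtain ⟨f, hf⟩ := exists_surjective_nat ι
  obtain ⟨s, hs⟩ := SigmaMVEffectAlgebra.exists_isLUB_range (a ∘ f)
  exact ⟨s, by rwa [hf.range_comp] at hs⟩

/-- The pairs of rational numbers whose sum is less than `t`. -/
abbrev RatPair (t : ℝ) : Type := {p : ℚ × ℚ // (p.1 + p.2 : ℝ) < t}

instance (t : ℝ) : Nonempty (RatPair t) :=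
  (exists_rat_lt t).elim fun r hr => ⟨⟨(r, 0), by simpa using hr⟩⟩

theorem IsSpectral.exists_sum {B C : ℝ → E} (hB : IsSpectral B) (hC : IsSpectral C) :
    ∃ D : ℝ → E, IsSpectral D ∧
      ∀ t, IsLUB (Set.range fun p : RatPair t => B p.1.1 ⊓ C p.1.2) (D t) := by
  choose D hD using fun t : ℝ =>
    exists_isLUB_of_countable fun p : RatPair t => B p.1.1 ⊓ C p.1.2
  have hle : ∀ (t : ℝ) (r s : ℚ), (r + s : ℝ) < t → B r ⊓ C s ≤ D t :=
    fun t r s h => (hD t).1 ⟨⟨(r, s), h⟩, rfl⟩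
  have hle' : ∀ (t : ℝ) (u : E), (∀ r s : ℚ, (r + s : ℝ) < t → B r ⊓ C s ≤ u) → D t ≤ u := by
    intro t u h
    refine (hD t).2 ?_
    rintro _ ⟨p, rfl⟩
    exact h _ _ p.2
  refine ⟨D, ⟨fun t => ⟨?_, fun u hu => hle' t u fun r s h => ?_⟩, ?_, ?_⟩, hD⟩
  · rintro _ ⟨q, rfl⟩
    exact hle' _ _ fun r s h => hle t r s (h.trans q.2)
  · obtain ⟨q, hq, hq'⟩ := exists_rat_btwn h
    exact (hle q r s hq).trans (hu ⟨⟨q, hq'⟩, rfl⟩)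
  · obtain ⟨α, hα⟩ := hB.exists_eq_zero
    obtain ⟨β, hβ⟩ := hC.exists_eq_zero
    refine ⟨α + β, eq_zero_of_le (hle' _ _ fun r s h => ?_)⟩
    -- As `r + s < α + β`, either `r ≤ α` or `s < β`.
    rcases le_or_gt (r : ℝ) α with hr | hr
    · exact inf_le_left.trans (hα ▸ hB.monotone hr)
    · exact inf_le_right.trans (hβ ▸ hC.monotone (by linarith))
  · obtain ⟨α, hα⟩ := hB.exists_eq_one
    obtain ⟨β, hβ⟩ := hC.exists_eq_one
    obtain ⟨r, hr⟩ := exists_rat_gt α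
    obtain ⟨s, hs⟩ := exists_rat_gt β
    refine ⟨r + s + 1, le_antisymm (le_one' _) (le_trans ?_ (hle _ r s (lt_add_one _)))⟩
    exact le_inf (hα ▸ hB.monotone hr.le) (hβ ▸ hC.monotone hs.le)

end EffectAlgebra

/-! ### Addition of bounded observables and its laws. -/

namespace BoundedObservable

variable {E : Type*} [SigmaMVEffectAlgebra E]

theorem isSpectral (x : BoundedObservable E) : IsSpectral x.1.spectral := by
  obtain ⟨α, β, h⟩ := x.2
  refine ⟨x.1.isLUB_spectral, ⟨α, ?_⟩, β + 1, le_antisymm (le_one' _) ?_⟩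
  · have hd : Disjoint (Set.Icc α β) (Set.Iio α) :=
      Set.disjoint_left.2 fun t ht ht' => (ht.1.trans_lt ht').false
    have := x.1.psum_union measurableSet_Icc measurableSet_Iio hd
    rw [h] at this
    exact eq_zero_of_le ((this.le_compl).trans compl_one.le)
  · rw [← h]
    exact x.1.mono _ _ fun t ht => ht.2.trans_lt (lt_add_one β)

theorem exists_of_isSpectral {B : ℝ → E} (hB : IsSpectral B) :
    ∃ x : BoundedObservable E, x.1.spectral = B := by
  obtain ⟨x, hx⟩ := hB.exists_observable
  refine ⟨⟨x, ?_⟩, ?_⟩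
  · obtain ⟨α, hα⟩ := hB.exists_eq_zero
    obtain ⟨β, hβ⟩ := hB.exists_eq_one
    obtain ⟨p, hp⟩ := exists_rat_lt α
    obtain ⟨q, hq⟩ := exists_rat_gt β
    have hp0 : x.spectral p = 0 := by
      rw [hx]
      exact eq_zero_of_le (hα ▸ hB.monotone hp.le)
    have hq1 : x.spectral q = 1 := by
      rw [hx]
      exact le_antisymm (le_one' _) (hβ ▸ hB.monotone hq.le)
    have hd : Disjoint (Set.Iio (p : ℝ)) (Set.Icc (p : ℝ) q) :=
      Set.disjoint_left.2 fun t ht ht' => (ht'.1.trans_lt ht).false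
    have h1 := x.psum_union measurableSet_Iio measurableSet_Icc hd
    have h2 : x.spectral q ≤ x.toFun ⟨_, measurableSet_Iio.union measurableSet_Icc⟩ :=
      x.mono measurableSet_Iio _ fun t ht => (lt_or_ge t (p : ℝ)).imp id fun h => ⟨h, le_of_lt ht⟩
    change PSum (x.spectral p) _ _ at h1
    rw [hp0] at h1
    refine ⟨p, q, le_antisymm (le_one' _) ?_⟩
    rw [(zero_psum _).unique h1, ← hq1]
    exact h2
  -- Agreement at rational points extends to all `t` by left continuity.
  · funext t
    have h := x.isLUB_spectral t
    simp only [hx] at h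
    exact h.unique (hB.isLUB t)

theorem ext_spectral {x y : BoundedObservable E} (h : ∀ t, x.1.spectral t = y.1.spectral t) :
    x = y :=
  Subtype.ext (Observable.ext_spectral fun q => h q)

/-- Left continuity of the second resolution at `t - r` replaces it by rational `s < t - r`, and
meets distribute over this supremum. -/
theorem isSum_iff {x y z : BoundedObservable E} :
    IsSum x y z ↔ ∀ t, IsLUB
      (Set.range fun p : RatPair t => x.1.spectral p.1.1 ⊓ y.1.spectral p.1.2)
      (z.1.spectral t) := by
  refine forall_congr' fun t => isLUB_congr (Set.ext fun u => ⟨fun hu => ?_, fun hu => ?_⟩)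
  · rintro _ ⟨⟨⟨r, s⟩, h⟩, rfl⟩
    exact (inf_le_inf_left _ (y.isSpectral.monotone (by simp only at h; linarith))).trans
      (hu ⟨r, rfl⟩)
  · rintro _ ⟨r, rfl⟩
    refine inf_le_of_isLUB (y.isSpectral.isLUB _) fun s => ?_
    have := s.2
    exact hu ⟨⟨(r, s.1), by simp only; linarith⟩, rfl⟩

theorem exists_isSum (x y : BoundedObservable E) : ∃ z, IsSum x y z := by
  obtain ⟨D, hD, h⟩ := x.isSpectral.exists_sum y.isSpectral
  obtain ⟨z, rfl⟩ := exists_of_isSpectral hD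
  exact ⟨z, isSum_iff.2 h⟩

theorem isSum_add (x y : BoundedObservable E) : IsSum x y (x + y) :=
  Classical.epsilon_spec (exists_isSum x y)

theorem IsSum.unique {x y z w : BoundedObservable E} (h : IsSum x y z) (h' : IsSum x y w) :
    z = w :=
  ext_spectral fun t => (h t).unique (h' t)

theorem spectral_add_le_iff {x y : BoundedObservable E} {t : ℝ} {u : E} :
    (x + y).1.spectral t ≤ u ↔
      ∀ r s : ℚ, (r + s : ℝ) < t → x.1.spectral r ⊓ y.1.spectral s ≤ u := by
  rw [isLUB_le_iff (isSum_iff.1 (isSum_add x y) t)]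
  exact ⟨fun h r s hrs => h ⟨⟨(r, s), hrs⟩, rfl⟩, fun h => by
    rintro _ ⟨p, rfl⟩
    exact h _ _ p.2⟩

theorem le_spectral_add (x y : BoundedObservable E) {t : ℝ} {r s : ℚ} (h : (r + s : ℝ) < t) :
    x.1.spectral r ⊓ y.1.spectral s ≤ (x + y).1.spectral t :=
  spectral_add_le_iff.1 le_rfl r s h

theorem add_comm' (x y : BoundedObservable E) : x + y = y + x := by
  refine ext_spectral fun t => eq_of_forall_ge_iff fun u => ?_
  rw [spectral_add_le_iff, spectral_add_le_iff, forall_comm]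
  simp only [inf_comm, add_comm]

theorem spectral_add_add_le_iff {x y z : BoundedObservable E} {t : ℝ} {u : E} :
    (x + y + z).1.spectral t ≤ u ↔ ∀ r s p : ℚ, (r + s + p : ℝ) < t →
      x.1.spectral r ⊓ y.1.spectral s ⊓ z.1.spectral p ≤ u := by
  rw [spectral_add_le_iff]
  constructor
  · intro h r s p hlt
    obtain ⟨q, hq, hq'⟩ := exists_rat_btwn (lt_sub_iff_add_lt.2 hlt)
    exact (inf_le_inf_right _ (le_spectral_add x y hq)).trans
      (h q p (lt_sub_iff_add_lt.1 hq'))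
  · intro h q p hlt
    rw [inf_comm]
    refine inf_le_of_isLUB (isSum_iff.1 (isSum_add x y) q) fun k => ?_
    rw [inf_comm]
    have := k.2
    exact h _ _ _ (by linarith)

theorem add_assoc' (x y z : BoundedObservable E) : x + y + z = x + (y + z) := by
  -- Both sides now have the shape of `spectral_add_add_le_iff`, whose criterion is invariant under
  -- permuting the summands.
  rw [add_comm' x (y + z)]
  refine ext_spectral fun t => eq_of_forall_ge_iff fun u => ?_
  rw [spectral_add_add_le_iff, spectral_add_add_le_iff]
  constructor
  · intro h r s p hlt
    rw [inf_comm, ← inf_assoc]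
    exact h p r s (by linarith)
  · intro h r s p hlt
    rw [inf_assoc, inf_comm]
    exact h s p r (by linarith)

theorem spectral_question_zero (t : ℝ) :
    (question (0 : E)).1.spectral t = if 0 < t then 1 else 0 := by
  change Observable.questionFun (0 : E) (Set.Iio t) = _
  simp only [Observable.questionFun, Set.mem_Iio, compl_zero, ite_self]

theorem add_question_zero (x : BoundedObservable E) : x + question (0 : E) = x := by
  refine ext_spectral fun t => eq_of_forall_ge_iff fun u => ?_
  rw [spectral_add_le_iff, isLUB_le_iff (x.isSpectral.isLUB t)]
  constructor
  · rintro h _ ⟨r, rfl⟩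
    obtain ⟨s, hs, hs'⟩ := exists_rat_btwn (sub_pos.2 r.2)
    have := h r s (by linarith)
    rwa [spectral_question_zero, if_pos hs, inf_eq_left.2 (le_one' _)] at this
  · intro h r s hrs
    rw [spectral_question_zero]
    split_ifs with hs
    · exact inf_le_left.trans (h ⟨⟨r, by linarith⟩, rfl⟩)
    · exact inf_le_right.trans (zero_le' u)

end BoundedObservable

theorem proposition3p5 {E : Type*} [SigmaMVEffectAlgebra E] :
    (∀ x y : BoundedObservable E, BoundedObservable.IsSum x y (x + y) ∧
      ∀ z : BoundedObservable E, BoundedObservable.IsSum x y z → z = x + y) ∧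
    (∀ x y : BoundedObservable E, x + y = y + x) ∧
    (∀ x y z : BoundedObservable E, (x + y) + z = x + (y + z)) ∧
    (∀ x : BoundedObservable E, x + BoundedObservable.question (0 : E) = x ∧
      BoundedObservable.question (0 : E) + x = x) := by
  refine ⟨fun x y => ⟨BoundedObservable.isSum_add x y,
    fun z hz => hz.unique (BoundedObservable.isSum_add x y)⟩, BoundedObservable.add_comm',
    BoundedObservable.add_assoc', fun x => ⟨BoundedObservable.add_question_zero x, ?_⟩⟩
  rw [BoundedObservable.add_comm', BoundedObservable.add_question_zero]
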